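/- All Banach lattices are real, and $1\le p,q\le\infty$. For $x_1,\dots,x_n$ in a Banach lattice, $\big(\sum_i|x_i|^r\big)^{1/r}$ is defined by the functional calculus and means $\bigvee_i|x_i|$ if $r=\infty$; for scalars, $\big(\sum_i|a_i|^r\big)^{1/r}$ means $\max_i|a_i|$ if $r=\infty$. A bounded operator $T:E\to X$ from a Banach space to a Banach lattice is $(p,r)$-convex if there is a constant $K\ge 1$ with $$\Big\|\Big(\sum_{i=1}^n|Te_i|^{r}\Big)^{1/r}\Big\|\le K\Big(\sum_{i=1}^n\|e_i\|^p\Big)^{1/p}\qquad\text{for all } n \text{ and } e_1,\dots,e_n\in E;$$ a bounded operator $T:X\to E$ is $(q,r)$-concave if there is a constant $K\ge 1$ with $$\Big(\sum_{i=1}^n\|Tx_i\|^q\Big)^{1/q}\le K\Big\|\Big(\sum_{i=1}^n|x_i|^{r}\Big)^{1/r}\Big\|\qquad\text{for all } n \text{ and } x_1,\dots,x_n\in X.$$ A Banach lattice is $(p,r)$-convex (respectively $(q,r)$-concave) if its identity operator is. A positive operator $S:X\to Y$ between Banach lattices is interval preserving if $S[0,x]=[0,Sx]$ for all $x\ge 0$;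 $S$ is of Class $\mathcal D$ if it is a lattice homomorphism with dense range. **Theorem.** Let $X,Y$ be Banach lattices, let $1\le p,q\le\infty$ and $p_2\in\{p,\infty\}$, and let $T:X\to Y$ be a bounded linear operator that is both $(p,p_2)$-convex and $(q,1)$-concave. Let $0<\theta<1$, and determine $p_\theta,q_\theta\in[1,\infty]$ by $\frac1{p_\theta}=\frac{\theta}{p}+(1-\theta)$ and $q_\theta=\frac{q}{1-\theta}$. Set $\overline{p_2}=p_\theta$ if $p_2=p$, and $\overline{p_2}=\infty$ if $p_2=\infty$ (if $p=p_2=\infty$, either choice is allowed). Then there exist 1. a $(p_\theta,\overline{p_2})$-convex Banach lattice $\mathcal Z_\theta$ and a $(q_\theta,1)$-concave Banach lattice $W_\theta$; 2. an injective, interval preserving lattice homomorphism $\Phi:\mathcal Z_\theta\to Y$ and a Class $\mathcal D$ operator $\Psi:X\to W_\theta$; 3. a bounded linear operator $T_\theta:W_\theta\to\mathcal Z_\theta$, such that $T=\Phi\,T_\theta\,\Psi$. -/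

import Mathlib

universe u v

open scoped ENNReal

/-- A (real) Banach lattice: a complete normed space with a compatible lattice order for which
`|x| ≤ |y|` implies `‖x‖ ≤ ‖y‖`. -/
class IsBanachLattice (X : Type*) [NormedAddCommGroup X] [NormedSpace ℝ X] [Lattice X] : Prop
    extends IsOrderedAddMonoid X, PosSMulMono ℝ X, HasSolidNorm X, CompleteSpace X

/-- The closed unit ball of `ℓ_{q*}^n`, where `q*` is the conjugate exponent of `q`. -/
def dualBall (q : ℝ≥0∞) (n : ℕ) : Set (Fin n → ℝ) :=
  {a | ‖WithLp.toLp q.conjExponent a‖ ≤ 1}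

theorem abs_le_one_of_mem_dualBall {q : ℝ≥0∞} {n : ℕ} {a : Fin n → ℝ} (ha : a ∈ dualBall q n)
    (i : Fin n) : |a i| ≤ 1 := by
  have : Fact (1 ≤ q.conjExponent) := ⟨le_self_add⟩
  have h := PiLp.norm_apply_le (WithLp.toLp q.conjExponent a) i
  exact le_trans h ha

theorem zero_mem_dualBall (q : ℝ≥0∞) (n : ℕ) : (0 : Fin n → ℝ) ∈ dualBall q n := by
  have : Fact (1 ≤ q.conjExponent) := ⟨le_self_add⟩
  simp [dualBall]

theorem exists_finset_dualBall (q : ℝ≥0∞) (n : ℕ) (ε : ℝ) (hε : 0 < ε) :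
    ∃ A : Finset (Fin n → ℝ), A.Nonempty ∧ (↑A ⊆ dualBall q n) ∧
      ∀ b ∈ dualBall q n, ∃ a ∈ A, ∀ i, |b i - a i| ≤ ε := by
  have hsub : dualBall q n ⊆ Set.Icc (fun _ => -1) (fun _ => 1) := fun a ha =>
    ⟨fun i => (abs_le.1 (abs_le_one_of_mem_dualBall ha i)).1,
      fun i => (abs_le.1 (abs_le_one_of_mem_dualBall ha i)).2⟩
  have htb : TotallyBounded (dualBall q n) := (isCompact_Icc.totallyBounded).subset hsub
  obtain ⟨t, hts, htf, hcov⟩ := Metric.finite_approx_of_totallyBounded htb ε hε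
  have key : ∀ b ∈ dualBall q n, ∃ a ∈ htf.toFinset, ∀ i, |b i - a i| ≤ ε := by
    intro b hb
    obtain ⟨a, ha, hba⟩ := Set.mem_iUnion₂.1 (hcov hb)
    refine ⟨a, htf.mem_toFinset.2 ha, fun i => ?_⟩
    have := (dist_le_pi_dist b a i).trans (le_of_lt (Metric.mem_ball.1 hba))
    simpa [Real.dist_eq] using this
  obtain ⟨a, ha, -⟩ := key 0 (zero_mem_dualBall q n)
  exact ⟨htf.toFinset, ⟨a, ha⟩, by simpa using hts, key⟩

section LpSum

variable {X : Type*} [NormedAddCommGroup X] [NormedSpace ℝ X] [Lattice X] [IsBanachLattice X]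

theorem sum_smul_le_of_close {n : ℕ} (x : Fin n → X) {a b : Fin n → ℝ} {ε : ℝ}
    (h : ∀ i, |b i - a i| ≤ ε) :
    ∑ i, b i • x i ≤ ∑ i, a i • x i + ε • ∑ i, |x i| := by
  rw [Finset.smul_sum, ← Finset.sum_add_distrib]
  refine Finset.sum_le_sum fun i _ => ?_
  have hx : 0 ≤ |x i| := abs_nonneg _
  have hp : 0 ≤ ε - (b i - a i) := by linarith [(abs_le.1 (h i)).2]
  have hm : 0 ≤ ε + (b i - a i) := by linarith [(abs_le.1 (h i)).1]
  have hpos : 0 ≤ |x i| - x i := sub_nonneg.2 (le_abs_self _)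
  have hneg : 0 ≤ |x i| + x i := by
    have := neg_le_abs (x i)
    rwa [neg_le_iff_add_nonneg] at this
  have h1 := add_nonneg (smul_nonneg hp hneg) (smul_nonneg hm hpos)
  have h2 : (ε - (b i - a i)) • (|x i| + x i) + (ε + (b i - a i)) • (|x i| - x i)
      = (2 : ℝ) • ((a i • x i + ε • |x i|) - b i • x i) := by module
  rw [h2] at h1
  have h3 := smul_nonneg (by norm_num : (0 : ℝ) ≤ 1 / 2) h1
  rw [smul_smul, show (1 / 2 : ℝ) * 2 = 1 by norm_num, one_smul] at h3
  exact sub_nonneg.1 h3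

/-- In a Banach lattice the supremum of `∑ aᵢ xᵢ` over the unit ball of `ℓ_{q*}^n` exists. -/
theorem exists_isLUB_dualBall (q : ℝ≥0∞) {n : ℕ} (x : Fin n → X) :
    ∃ s : X, IsLUB ((fun a : Fin n → ℝ => ∑ i, a i • x i) '' dualBall q n) s := by
  have hpos : ∀ k : ℕ, (0 : ℝ) < 1 / ((k : ℝ) + 1) := fun k => by positivity
  choose A hne hsub hA using fun k : ℕ => exists_finset_dualBall q n (1 / ((k : ℝ) + 1)) (hpos k)
  set L : (Fin n → ℝ) → X := fun a => ∑ i, a i • x i with hL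
  set e : X := ∑ i, |x i| with he
  have he0 : 0 ≤ e := Finset.sum_nonneg fun i _ => abs_nonneg _
  set s : ℕ → X := fun k => (A k).sup' (hne k) L with hs
  have hup : ∀ k, ∀ b ∈ dualBall q n, L b ≤ s k + (1 / ((k : ℝ) + 1)) • e := by
    intro k b hb
    obtain ⟨a, ha, hab⟩ := hA k b hb
    exact (sum_smul_le_of_close x hab).trans (by gcongr; exact Finset.le_sup' L ha)
  have hle : ∀ k l, s l ≤ s k + (1 / ((k : ℝ) + 1)) • e := fun k l =>
    Finset.sup'_le _ _ fun a ha => hup k a (hsub l ha)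
  have hlim : Filter.Tendsto (fun k : ℕ => (1 / ((k : ℝ) + 1)) • e) Filter.atTop (nhds 0) := by
    have := (tendsto_one_div_add_atTop_nhds_zero_nat (𝕜 := ℝ)).smul_const e
    simpa using this
  have hcau : CauchySeq s := by
    refine cauchySeq_of_le_tendsto_0 (fun k : ℕ => ‖(1 / ((k : ℝ) + 1)) • e‖) ?_
      (by simpa using hlim.norm)
    intro k l N hk hl
    rw [dist_eq_norm]
    refine norm_le_norm_of_abs_le_abs ?_
    refine le_trans ?_ (le_abs_self _)
    refine abs_le'.2 ⟨?_, ?_⟩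
    · rw [sub_le_iff_le_add']
      exact (hle l k).trans (by gcongr)
    · rw [neg_sub, sub_le_iff_le_add']
      exact (hle k l).trans (by gcongr)
  obtain ⟨s₀, hs₀⟩ := cauchySeq_tendsto_of_complete hcau
  refine ⟨s₀, ?_, ?_⟩
  · rintro _ ⟨b, hb, rfl⟩
    have := hs₀.add hlim
    rw [add_zero] at this
    exact ge_of_tendsto this (Filter.Eventually.of_forall fun k => hup k b hb)
  · intro y hy
    exact le_of_tendsto hs₀ (Filter.Eventually.of_forall fun k =>
      Finset.sup'_le _ _ fun a ha => hy ⟨a, hsub k ha, rfl⟩)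

/-- The element `(∑ |xᵢ|^q)^{1/q}` of a Banach lattice, `1 ≤ q ≤ ∞` (the finite supremum
`⋁ |xᵢ|` if `q = ∞`), as the supremum of all `∑ aᵢ xᵢ` with `(aᵢ)` in the unit ball of
`ℓ_{q*}^n`. That this is the value given by the (Krivine) functional calculus is
`lpSum_eq_functionalCalculus` below. -/
noncomputable def lpSum (q : ℝ≥0∞) {n : ℕ} (x : Fin n → X) : X :=
  Classical.choose (exists_isLUB_dualBall q x)

theorem isLUB_lpSum (q : ℝ≥0∞) {n : ℕ} (x : Fin n → X) :
    IsLUB ((fun a : Fin n → ℝ => ∑ i, a i • x i) '' dualBall q n) (lpSum q x) :=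
  Classical.choose_spec (exists_isLUB_dualBall q x)

end LpSum

/-- The vector lattice of continuous positively homogeneous functions on `ℝⁿ`. -/
def homogeneousFunctions (n : ℕ) : Submodule ℝ ((Fin n → ℝ) → ℝ) where
  carrier := {f | Continuous f ∧ ∀ (c : ℝ), 0 ≤ c → ∀ t, f (c • t) = c * f t}
  add_mem' := by
    rintro f g ⟨hf, hf'⟩ ⟨hg, hg'⟩
    exact ⟨hf.add hg, fun c hc t => by simp [hf' c hc, hg' c hc, mul_add]⟩
  zero_mem' := ⟨continuous_const, fun c hc t => by simp⟩
  smul_mem' := by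
    rintro r f ⟨hf, hf'⟩
    exact ⟨hf.const_smul r, fun c hc t => by simp [hf' c hc]; ring⟩

/-- `τ` is the functional calculus at `x = (x₁, …, xₙ)`: a lattice homomorphism on the continuous
positively homogeneous functions which sends the `i`-th coordinate function to `xᵢ`. -/
structure IsFunctionalCalculus {X : Type*} [NormedAddCommGroup X] [NormedSpace ℝ X] [Lattice X]
    {n : ℕ} (x : Fin n → X) (τ : homogeneousFunctions n →ₗ[ℝ] X) : Prop where
  map_sup : ∀ f g h : homogeneousFunctions n,
    (h : (Fin n → ℝ) → ℝ) = (f : (Fin n → ℝ) → ℝ) ⊔ (g : (Fin n → ℝ) → ℝ) → τ h = τ f ⊔ τ g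
  map_coord : ∀ (i : Fin n) (f : homogeneousFunctions n),
    (f : (Fin n → ℝ) → ℝ) = (fun t => t i) → τ f = x i

section Consistency

variable {X : Type*} [NormedAddCommGroup X] [NormedSpace ℝ X] [Lattice X] [IsBanachLattice X]

theorem norm_toLp_fin {q : ℝ≥0∞} (h1 : 1 < q) (hT : q ≠ ⊤) {n : ℕ} (t : Fin n → ℝ) :
    ‖WithLp.toLp q t‖ = (∑ i, |t i| ^ q.toReal) ^ (1 / q.toReal) := by
  rw [PiLp.norm_eq_sum (ENNReal.toReal_pos (by positivity) hT)]
  simp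

theorem holderConjugate_conjExponent_toReal {q : ℝ≥0∞} (h1 : 1 < q) (hT : q ≠ ⊤) :
    q.toReal.HolderConjugate q.conjExponent.toReal ∧ 1 < q.conjExponent ∧
      q.conjExponent ≠ ⊤ := by
  have h2 : 1 < q.conjExponent := by
    rw [ENNReal.conjExponent]
    have : 0 < (q - 1)⁻¹ := ENNReal.inv_pos.2 (by finiteness)
    exact ENNReal.lt_add_right ENNReal.one_ne_top this.ne'
  have h3 : q.conjExponent ≠ ⊤ := by
    rw [ENNReal.conjExponent]
    have : q - 1 ≠ 0 := (tsub_pos_of_lt h1).ne'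
    finiteness
  have h := ENNReal.HolderConjugate.conjExponent h1.le
  refine ⟨?_, h2, h3⟩
  have hq1 : 1 < q.toReal := by
    rw [← ENNReal.toReal_one]; exact (ENNReal.toReal_lt_toReal ENNReal.one_ne_top hT).2 h1
  rw [Real.holderConjugate_iff]
  refine ⟨hq1, ?_⟩
  have := h.inv_add_inv_eq_one
  rw [← ENNReal.toReal_inv, ← ENNReal.toReal_inv, ← ENNReal.toReal_add, this,
    ENNReal.toReal_one]
  · exact ENNReal.inv_ne_top.2 (by positivity)
  · exact ENNReal.inv_ne_top.2 (by positivity)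

theorem isGreatest_dualBall (q : ℝ≥0∞) (hq : 1 ≤ q) {n : ℕ} (t : Fin n → ℝ) :
    IsGreatest ((fun a : Fin n → ℝ => ∑ i, a i * t i) '' dualBall q n) ‖WithLp.toLp q t‖ := by
  rcases hq.eq_or_lt with rfl | h1
  · have hc : (1 : ℝ≥0∞).conjExponent = ⊤ := by simp [ENNReal.conjExponent]
    have hn : ‖WithLp.toLp 1 t‖ = ∑ i, |t i| := by
      rw [PiLp.norm_eq_sum (by simp)]; simp
    rw [hn]
    refine ⟨⟨fun i => SignType.sign (t i), ?_, ?_⟩, ?_⟩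
    · change ‖WithLp.toLp (1 : ℝ≥0∞).conjExponent _‖ ≤ 1
      rw [hc, PiLp.norm_toLp]
      refine (pi_norm_le_iff_of_nonneg zero_le_one).2 fun i => ?_
      rcases lt_trichotomy (t i) 0 with h | h | h <;> simp [h]
    · simp [sign_mul_self]
    · rintro _ ⟨a, ha, rfl⟩
      refine Finset.sum_le_sum fun i _ => (le_abs_self _).trans ?_
      rw [abs_mul]
      exact mul_le_of_le_one_left (abs_nonneg _) (abs_le_one_of_mem_dualBall ha i)
  rcases eq_or_ne q ⊤ with rfl | hT
  · have hc : (⊤ : ℝ≥0∞).conjExponent = 1 := by simp [ENNReal.conjExponent]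
    have hn1 : ∀ a : Fin n → ℝ, ‖WithLp.toLp 1 a‖ = ∑ i, |a i| := fun a => by
      rw [PiLp.norm_eq_sum (by simp)]; simp
    have hmem : ∀ a : Fin n → ℝ, a ∈ dualBall ⊤ n ↔ ∑ i, |a i| ≤ 1 := fun a => by
      change ‖WithLp.toLp (⊤ : ℝ≥0∞).conjExponent a‖ ≤ 1 ↔ _
      rw [hc, hn1]
    rw [PiLp.norm_toLp]
    refine ⟨?_, ?_⟩
    · rcases isEmpty_or_nonempty (Fin n) with hE | hE
      · exact ⟨0, zero_mem_dualBall _ _, by simp [Pi.norm_def]⟩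
      · obtain ⟨i, hi⟩ := Finite.exists_max fun i => |t i|
        have hn : ‖t‖ = |t i| :=
          le_antisymm ((pi_norm_le_iff_of_nonneg (abs_nonneg _)).2 hi) (norm_le_pi_norm t i)
        refine ⟨Pi.single i (SignType.sign (t i) : ℝ), (hmem _).2 ?_, ?_⟩
        · rw [Finset.sum_eq_single i (fun j _ hj => by simp [hj]) (by simp), Pi.single_eq_same]
          rcases lt_trichotomy (t i) 0 with h | h | h <;> simp [h]
        · change ∑ j, _ = _
          rw [Finset.sum_eq_single i (fun j _ hj => by simp [hj]) (by simp), Pi.single_eq_same, hn,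
            sign_mul_self]
    · rintro _ ⟨a, ha, rfl⟩
      calc ∑ i, a i * t i ≤ ∑ i, |a i| * ‖t‖ := Finset.sum_le_sum fun i _ =>
            (le_abs_self _).trans (by rw [abs_mul]; gcongr; exact norm_le_pi_norm t i)
        _ ≤ ‖t‖ := by
            rw [← Finset.sum_mul]
            exact mul_le_of_le_one_left (norm_nonneg _) ((hmem a).1 ha)
  · obtain ⟨hpq, h1', hT'⟩ := holderConjugate_conjExponent_toReal h1 hT
    rw [norm_toLp_fin h1 hT]
    have hmem : ∀ a : Fin n → ℝ, a ∈ dualBall q n ↔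
        (∑ i, |a i| ^ q.conjExponent.toReal) ^ (1 / q.conjExponent.toReal) ≤ 1 := fun a => by
      rw [← norm_toLp_fin h1' hT']; rfl
    refine ⟨?_, ?_⟩
    · obtain ⟨g, hg, hgt⟩ := (NNReal.isGreatest_Lp Finset.univ (fun i => ‖t i‖₊) hpq).1
      have hg' : ∑ i, (g i : ℝ) ^ q.conjExponent.toReal ≤ 1 := by exact_mod_cast hg
      have hgt' : ∑ i, |t i| * (g i : ℝ) = (∑ i, |t i| ^ q.toReal) ^ (1 / q.toReal) := by
        have := congrArg (fun r : NNReal => (r : ℝ)) hgt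
        simpa using this
      refine ⟨fun i => SignType.sign (t i) * g i, (hmem _).2 ?_, ?_⟩
      · refine Real.rpow_le_one (Finset.sum_nonneg fun i _ => by positivity) ?_ (by positivity)
        refine le_trans (Finset.sum_le_sum fun i _ => ?_) hg'
        refine Real.rpow_le_rpow (abs_nonneg _) ?_ ENNReal.toReal_nonneg
        rcases lt_trichotomy (t i) 0 with h | h | h <;> simp [h]
      · rw [← hgt']
        refine Finset.sum_congr rfl fun i _ => ?_
        rw [mul_right_comm, sign_mul_self]
    · rintro _ ⟨a, ha, rfl⟩
      refine (Real.inner_le_Lp_mul_Lq Finset.univ a t hpq.symm).trans ?_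
      exact mul_le_of_le_one_left (by positivity) ((hmem a).1 ha)

/-- The functional calculus sends `t ↦ (∑ |tᵢ|^q)^{1/q}` to `lpSum q x`. -/
theorem lpSum_eq_functionalCalculus (q : ℝ≥0∞) (hq : 1 ≤ q) {n : ℕ} (x : Fin n → X)
    (τ : homogeneousFunctions n →ₗ[ℝ] X) (hτ : IsFunctionalCalculus x τ)
    (h : homogeneousFunctions n)
    (hh : ∀ t, (h : (Fin n → ℝ) → ℝ) t = ‖WithLp.toLp q t‖) : τ h = lpSum q x := by
  have hmono : ∀ f g : homogeneousFunctions n, (∀ t, f.1 t ≤ g.1 t) → τ f ≤ τ g := by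
    intro f g hfg
    have := hτ.map_sup f g g (by ext t; simp [hfg t])
    rw [this]; exact le_sup_left
  have hcoord : ∀ i : Fin n, (fun t : Fin n → ℝ => t i) ∈ homogeneousFunctions n := fun i =>
    ⟨continuous_apply i, fun c _ t => by simp⟩
  set ℓ : (Fin n → ℝ) → homogeneousFunctions n := fun a =>
    ∑ i, a i • ⟨fun t => t i, hcoord i⟩ with hℓ
  have hℓt : ∀ a t, (ℓ a).1 t = ∑ i, a i * t i := by
    intro a t; simp [hℓ, Finset.sum_apply]
  have hτℓ : ∀ a, τ (ℓ a) = ∑ i, a i • x i := by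
    intro a
    simp only [hℓ, map_sum, map_smul]
    exact Finset.sum_congr rfl fun i _ => by rw [hτ.map_coord i _ rfl]
  have habs : (fun t : Fin n → ℝ => ∑ i, |t i|) ∈ homogeneousFunctions n :=
    ⟨by fun_prop, fun c hc t => by simp [abs_mul, abs_of_nonneg hc, Finset.mul_sum]⟩
  set e : homogeneousFunctions n := ⟨_, habs⟩ with he
  have hfin : ∀ (A : Finset (Fin n → ℝ)) (hA : A.Nonempty), ∃ f : homogeneousFunctions n,
      (∀ a ∈ A, ∀ t, (ℓ a).1 t ≤ f.1 t) ∧ ∀ y, (∀ a ∈ A, τ (ℓ a) ≤ y) → τ f ≤ y := by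
    intro A hA
    induction hA using Finset.Nonempty.cons_induction with
    | singleton a => exact ⟨ℓ a, by simp, by simp⟩
    | cons a s ha hs ih =>
      obtain ⟨f, hf1, hf2⟩ := ih
      have hm : (ℓ a).1 ⊔ f.1 ∈ homogeneousFunctions n :=
        ⟨(ℓ a).2.1.sup f.2.1, fun c hc t => by
          rw [Pi.sup_apply, Pi.sup_apply, (ℓ a).2.2 c hc, f.2.2 c hc, mul_max_of_nonneg _ _ hc]⟩
      refine ⟨⟨_, hm⟩, ?_, ?_⟩
      · intro b hb t
        rcases Finset.mem_cons.1 hb with rfl | hb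
        · exact le_sup_left
        · exact (hf1 b hb t).trans le_sup_right
      · intro y hy
        rw [hτ.map_sup (ℓ a) f ⟨_, hm⟩ rfl]
        exact sup_le (hy a (Finset.mem_cons_self a s))
          (hf2 y fun b hb => hy b (Finset.mem_cons_of_mem hb))
  have hlub : IsLUB ((fun a : Fin n → ℝ => ∑ i, a i • x i) '' dualBall q n) (τ h) := by
    refine ⟨?_, fun y hy => ?_⟩
    · rintro _ ⟨b, hb, rfl⟩
      simp only [← hτℓ]
      refine hmono _ _ fun t => ?_
      rw [hℓt, hh]
      exact (isGreatest_dualBall q hq t).2 ⟨b, hb, rfl⟩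
    · have hε : ∀ ε : ℝ, 0 < ε → τ h ≤ y + ε • τ e := by
        intro ε hε
        obtain ⟨A, hne, hsub, hA⟩ := exists_finset_dualBall q n ε hε
        obtain ⟨f, hf1, hf2⟩ := hfin A hne
        have h1 : τ h ≤ τ (f + ε • e) := by
          refine hmono _ _ fun t => ?_
          obtain ⟨b, hb, hbt⟩ := (isGreatest_dualBall q hq t).1
          obtain ⟨a, ha, hab⟩ := hA b hb
          rw [hh, ← hbt]
          have h2 := hf1 a ha t
          rw [hℓt] at h2
          have h3 : ∑ i, b i * t i ≤ ∑ i, a i * t i + ε * ∑ i, |t i| := by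
            rw [Finset.mul_sum, ← Finset.sum_add_distrib]
            refine Finset.sum_le_sum fun i _ => ?_
            have h4 : (b i - a i) * t i ≤ ε * |t i| :=
              (le_abs_self _).trans (by rw [abs_mul]; gcongr; exact hab i)
            linarith
          exact h3.trans (by simpa [he] using h2)
        rw [map_add, map_smul] at h1
        exact h1.trans (by gcongr; exact hf2 y fun a ha => by rw [hτℓ]; exact hy ⟨a, hsub ha, rfl⟩)
      have hlim : Filter.Tendsto (fun k : ℕ => y + (1 / ((k : ℝ) + 1)) • τ e) Filter.atTop
          (nhds y) := by
        have := ((tendsto_one_div_add_atTop_nhds_zero_nat (𝕜 := ℝ)).smul_const (τ e)).const_add y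
        simpa using this
      exact ge_of_tendsto hlim (Filter.Eventually.of_forall fun k => hε _ (by positivity))
  exact hlub.unique (isLUB_lpSum q x)

end Consistency

section Operators

variable {E F X Y : Type*} [NormedAddCommGroup E] [NormedSpace ℝ E]
  [NormedAddCommGroup F] [NormedSpace ℝ F]
  [NormedAddCommGroup X] [NormedSpace ℝ X] [Lattice X]
  [NormedAddCommGroup Y] [NormedSpace ℝ Y] [Lattice Y]

/-- `T : E → X` is `(p,q)`-convex: for some constant `K ≥ 1`,
`‖(∑ |T eᵢ|^q)^{1/q}‖ ≤ K (∑ ‖eᵢ‖^p)^{1/p}` for all finite sequences `(eᵢ)` in `E`. -/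
def IsConvexOperator [IsBanachLattice X] (p q : ℝ≥0∞) (T : E →L[ℝ] X) : Prop :=
  ∃ K : ℝ, 1 ≤ K ∧ ∀ (n : ℕ) (e : Fin n → E),
    ‖lpSum q (fun i => T (e i))‖ ≤ K * ‖WithLp.toLp p (fun i => ‖e i‖)‖

/-- `T : X → F` is `(p,q)`-concave: for some constant `K ≥ 1`,
`(∑ ‖T xᵢ‖^p)^{1/p} ≤ K ‖(∑ |xᵢ|^q)^{1/q}‖` for all finite sequences `(xᵢ)` in `X`. -/
def IsConcaveOperator [IsBanachLattice X] (p q : ℝ≥0∞) (T : X →L[ℝ] F) : Prop :=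
  ∃ K : ℝ, 1 ≤ K ∧ ∀ (n : ℕ) (x : Fin n → X),
    ‖WithLp.toLp p (fun i => ‖T (x i)‖)‖ ≤ K * ‖lpSum q x‖

/-- A Banach lattice is `(p,q)`-convex if its identity operator is. -/
def IsConvexLattice (p q : ℝ≥0∞) (X : Type*) [NormedAddCommGroup X] [NormedSpace ℝ X] [Lattice X]
    [IsBanachLattice X] : Prop :=
  IsConvexOperator p q (ContinuousLinearMap.id ℝ X)

/-- A Banach lattice is `(p,q)`-concave if its identity operator is. -/
def IsConcaveLattice (p q : ℝ≥0∞) (X : Type*) [NormedAddCommGroup X] [NormedSpace ℝ X] [Lattice X]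
    [IsBanachLattice X] : Prop :=
  IsConcaveOperator p q (ContinuousLinearMap.id ℝ X)

/-- Lattice homomorphisms (linear maps preserving the lattice operations). -/
def IsLatticeHom (T : X →L[ℝ] Y) : Prop :=
  ∀ x y : X, T (x ⊔ y) = T x ⊔ T y ∧ T (x ⊓ y) = T x ⊓ T y

/-- `T` is positive and `T [0, x] = [0, T x]` for every `x ≥ 0`. -/
def IsIntervalPreserving (T : X →L[ℝ] Y) : Prop :=
  (∀ x : X, 0 ≤ x → 0 ≤ T x) ∧ ∀ x : X, 0 ≤ x → T '' Set.Icc 0 x = Set.Icc 0 (T x)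

/-- Class `𝒟`: lattice homomorphisms with dense range. -/
def IsClassD (T : X →L[ℝ] Y) : Prop :=
  IsLatticeHom T ∧ DenseRange T

end Operators

/-! The factorization is a real interpolation argument done by hand, between the given convexity of
`T` and the trivial `ℓ¹` estimate, and between the norm of `X` and a functional `ρ` extracted from
concavity.

Concavity makes `ρ(y) = sup (∑ ‖T xᵢ‖^q)^{1/q}`, over finite families with `∑ |xᵢ| ≤ |y|`, finite;
concatenating families gives it a lower `q`-estimate (`exists_isLowerNorm`; for `q = ∞`, `‖T‖ ‖·‖`
serves). Call `x` an atom if `‖x‖ ≤ a`, `ρ x ≤ b` and `a^θ b^{1-θ} = 1`. The gauge of the convex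
hull of the atoms is a solid seminorm, and `W` is its Hausdorff completion. Below one atom `a` is
fixed and only `ρ^{1-θ}` varies, which yields the lower `q/(1-θ)`-estimate; Riesz decomposition and
Minkowski's inequality carry it to the hull (`IsLowerNorm.norm_toLp_seminorm_le`).

On the convex side, let the `eᵢ` be atoms with weights `cᵢ`, and write `cᵢ = uᵢ^θ vᵢ^{1-θ}`. A
Hölder–Young inequality (`lpSum_geom_mean_le`) bounds the `lpSum` of the `cᵢ T eᵢ` by `θ` times the
`lpSum` of the `uᵢ T eᵢ`, controlled by convexity of `T` through the `aᵢ`, plus `1-θ` times `∑ vᵢ |T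
eᵢ|`, controlled by the triangle inequality and `‖T eᵢ‖ ≤ ρ(eᵢ) ≤ bᵢ`. Sublinearity of `lpSum`
passes this to the hull and continuity to `W`, so `T` induces a convex operator `S` on `W`.

Finally every convex operator into `Y` factors through a convex order ideal of `Y`
(`exists_factorization_convexLattice`); applied to `S` this gives `Z`. -/

/-! ### Riesz decomposition and solid sets in vector lattices. -/

section VectorLattice

variable {V : Type*} [AddCommGroup V] [Lattice V] [IsOrderedAddMonoid V]

/-- Truncate `y` to the interval `[-a, a]`; the hypothesis bounds what is cut off by `b`. -/
theorem exists_abs_le_add_eq {y a b : V} (ha : 0 ≤ a) (hb : 0 ≤ b) (h : |y| ≤ a + b) :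
    ∃ y₁ y₂, y = y₁ + y₂ ∧ |y₁| ≤ a ∧ |y₂| ≤ b := by
  have h1 : y ≤ a + b := (le_abs_self y).trans h
  have h2 : -y ≤ a + b := (neg_le_abs y).trans h
  refine ⟨(y ⊓ a) ⊔ -a, y - (y ⊓ a) ⊔ -a, by abel, ?_, ?_⟩
  · refine abs_le'.2 ⟨sup_le inf_le_right (neg_le_self ha), ?_⟩
    rw [neg_le]; exact le_sup_right
  · refine abs_le'.2 ⟨?_, ?_⟩
    · rw [sub_le_comm]
      refine le_trans (le_inf ?_ ?_) le_sup_left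
      · exact sub_le_self _ hb
      · rwa [sub_le_iff_le_add]
    · rw [neg_sub, sub_le_iff_le_add]
      refine sup_le (inf_le_left.trans (le_add_of_nonneg_left hb)) ?_
      rw [neg_le_iff_add_nonneg, ← neg_le_iff_add_nonneg']
      have : -y ≤ b + a := by rwa [add_comm]
      calc -(b + y) = -y - b := by abel
        _ ≤ a := by rwa [sub_le_iff_le_add]

/-- Riesz decomposition for finite families. -/
theorem exists_sum_abs_le_add_eq {ι : Type*} (s : Finset ι) (x : ι → V) {a b : V} (ha : 0 ≤ a)
    (hb : 0 ≤ b) (h : ∑ i ∈ s, |x i| ≤ a + b) :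
    ∃ x₁ x₂ : ι → V, x = x₁ + x₂ ∧ ∑ i ∈ s, |x₁ i| ≤ a ∧ ∑ i ∈ s, |x₂ i| ≤ b := by
  classical
  induction s using Finset.induction_on generalizing a b with
  | empty => exact ⟨x, 0, by simp, by simpa, by simpa⟩
  | insert j s hj ih =>
    rw [Finset.sum_insert hj] at h
    have h0 : 0 ≤ ∑ i ∈ s, |x i| := Finset.sum_nonneg fun i _ => abs_nonneg _
    obtain ⟨z₁, z₂, hz, hz₁, hz₂⟩ :=
      exists_abs_le_add_eq ha hb ((le_add_of_nonneg_right h0).trans h)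
    -- Splitting `|x j|` exactly, rather than only `x j`, leaves budgets `a - s₁` and `b - s₂` whose
    -- sum is `a + b - |x j|`, just what the remaining indices need.
    obtain ⟨s₁, s₂, hs, hs₁, hs₂⟩ : ∃ s₁ s₂ : V, |x j| = s₁ + s₂ ∧ (0 ≤ s₁ ∧ s₁ ≤ a) ∧
        0 ≤ s₂ ∧ s₂ ≤ b := by
      refine ⟨|x j| ⊓ a, |x j| - |x j| ⊓ a, by abel, ⟨le_inf (abs_nonneg _) ha, inf_le_right⟩,
        sub_nonneg.2 inf_le_left, ?_⟩
      rw [sub_le_comm]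
      exact le_inf (sub_le_self _ hb)
        (by rw [sub_le_iff_le_add]; exact (le_add_of_nonneg_right h0).trans h)
    obtain ⟨z₁, z₂, hz, hz₁, hz₂⟩ := exists_abs_le_add_eq hs₁.1 hs₂.1 hs.le
    obtain ⟨x₁, x₂, hx, hx₁, hx₂⟩ := ih (sub_nonneg.2 hs₁.2) (sub_nonneg.2 hs₂.2) (by
      calc ∑ i ∈ s, |x i| = |x j| + ∑ i ∈ s, |x i| - |x j| := by abel
        _ ≤ a + b - |x j| := by gcongr
        _ = _ := by rw [hs]; abel)
    have hne : ∀ i ∈ s, i ≠ j := fun i hi h => hj (h ▸ hi)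
    refine ⟨Function.update x₁ j z₁, Function.update x₂ j z₂, ?_, ?_, ?_⟩
    · ext i
      by_cases hij : i = j
      · subst hij; simpa using hz
      · simp [hij, hx]
    · rw [Finset.sum_insert hj, Function.update_self,
        Finset.sum_congr rfl fun i hi => by rw [Function.update_of_ne (hne i hi)]]
      calc _ ≤ s₁ + (a - s₁) := add_le_add hz₁ hx₁
        _ = a := by abel
    · rw [Finset.sum_insert hj, Function.update_self,
        Finset.sum_congr rfl fun i hi => by rw [Function.update_of_ne (hne i hi)]]
      calc _ ≤ s₂ + (b - s₂) := add_le_add hz₂ hx₂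
        _ = b := by abel

/-- A sum of suprema is bounded by any bound of the sums of the elements. -/
theorem sum_le_of_isLUB {ι : Type*} [Fintype ι] (S : ι → Set V) (L : ι → V)
    (h : ∀ i, IsLUB (S i) (L i)) {z : V}
    (hz : ∀ x : ι → V, (∀ i, x i ∈ S i) → ∑ i, x i ≤ z) : ∑ i, L i ≤ z := by
  classical
  -- The entries are replaced by suprema one index at a time: with the other summands moved to the
  -- right, the bound says that a fixed element is an upper bound of `S j`.
  have key : ∀ F : Finset ι, ∀ x : ι → V, (∀ i ∈ F, x i = L i) → (∀ i ∉ F, x i ∈ S i) →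
      ∑ i, x i ≤ z := by
    intro F
    induction F using Finset.induction_on with
    | empty => exact fun x _ hx => hz x fun i => hx i (by simp)
    | insert j F hj ih =>
      intro x hx hx'
      have hxj : x j ≤ z - ∑ i ∈ Finset.univ.erase j, x i := by
        rw [hx j (Finset.mem_insert_self j F)]
        refine (h j).2 fun w hw => ?_
        rw [le_sub_iff_add_le]
        have := ih (Function.update x j w) (fun i hi => by
            have hij : i ≠ j := fun h => hj (h ▸ hi)
            rw [Function.update_of_ne hij, hx i (Finset.mem_insert_of_mem hi)])
          (fun i hi => by
            by_cases hij : i = j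
            · subst hij; simpa using hw
            · rw [Function.update_of_ne hij]
              exact hx' i (by simp [hij, hi]))
        rw [← Finset.add_sum_erase _ _ (Finset.mem_univ j), Function.update_self] at this
        rwa [Finset.sum_congr rfl fun i hi => by
          rw [Function.update_of_ne (Finset.ne_of_mem_erase hi)]] at this
      rw [← Finset.add_sum_erase _ _ (Finset.mem_univ j)]
      rwa [le_sub_iff_add_le] at hxj
  exact key Finset.univ L (fun i _ => rfl) (fun i hi => absurd (Finset.mem_univ i) hi)

variable [Module ℝ V] [PosSMulMono ℝ V]

theorem smul_sup_of_nonneg {V : Type*} [AddCommGroup V] [Lattice V] [Module ℝ V] [PosSMulMono ℝ V]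
    {c : ℝ} (hc : 0 ≤ c) (x y : V) : c • (x ⊔ y) = c • x ⊔ c • y := by
  rcases hc.eq_or_lt with rfl | hc
  · simp
  refine le_antisymm ?_ (sup_le (smul_le_smul_of_nonneg_left le_sup_left hc.le)
    (smul_le_smul_of_nonneg_left le_sup_right hc.le))
  have h : x ⊔ y ≤ c⁻¹ • (c • x ⊔ c • y) := by
    refine sup_le ?_ ?_
    · have := smul_le_smul_of_nonneg_left (le_sup_left : c • x ≤ c • x ⊔ c • y)
        (inv_nonneg.2 hc.le)
      rwa [inv_smul_smul₀ hc.ne'] at this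
    · have := smul_le_smul_of_nonneg_left (le_sup_right : c • y ≤ c • x ⊔ c • y)
        (inv_nonneg.2 hc.le)
      rwa [inv_smul_smul₀ hc.ne'] at this
  have := smul_le_smul_of_nonneg_left h hc.le
  rwa [smul_inv_smul₀ hc.ne'] at this

theorem abs_smul_eq (c : ℝ) (x : V) : |c • x| = |c| • |x| := by
  rcases le_total 0 c with hc | hc
  · rw [abs_of_nonneg hc, abs, abs, smul_sup_of_nonneg hc, smul_neg]
  · rw [abs_of_nonpos hc, abs, abs, smul_sup_of_nonneg (neg_nonneg.2 hc), sup_comm]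
    simp

theorem smul_le_abs_smul_abs (c : ℝ) (x : V) : c • x ≤ |c| • |x| :=
  (le_abs_self _).trans (abs_smul_eq c x).le

theorem smul_le_smul_right_of_nonneg {c d : ℝ} (h : c ≤ d) {x : V} (hx : 0 ≤ x) :
    c • x ≤ d • x := by
  rw [← sub_nonneg, ← sub_smul]
  have := smul_le_smul_of_nonneg_left hx (sub_nonneg.2 h)
  rwa [smul_zero] at this

/-- A set is solid if it contains with `x` every `y` such that `|y| ≤ |x|`. -/
def IsSolidSet (s : Set V) : Prop := ∀ x ∈ s, ∀ y, |y| ≤ |x| → y ∈ s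

/-- The points all of whose dominated elements lie in the hull include `s`, and Riesz decomposition
shows that they form a convex set. -/
theorem IsSolidSet.convexHull {s : Set V} (hs : IsSolidSet s) :
    IsSolidSet (convexHull ℝ s) := by
  have hc : Convex ℝ {x : V | ∀ y, |y| ≤ |x| → y ∈ _root_.convexHull ℝ s} := by
    rw [convex_iff_forall_pos]
    intro x hx x' hx' a b ha hb hab y hy
    obtain ⟨y₁, y₂, rfl, h₁, h₂⟩ := exists_abs_le_add_eq (abs_nonneg (a • x)) (abs_nonneg (b • x'))
      (hy.trans (abs_add_le _ _))
    have key : ∀ {c : ℝ}, 0 < c → ∀ {z w : V}, |z| ≤ |c • w| → |c⁻¹ • z| ≤ |w| := by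
      intro c hc z w h
      rw [abs_smul_eq, abs_of_pos hc] at h
      rw [abs_smul_eq, abs_of_pos (inv_pos.2 hc)]
      have := smul_le_smul_of_nonneg_left h (inv_nonneg.2 hc.le)
      rwa [inv_smul_smul₀ hc.ne'] at this
    have := convex_convexHull ℝ s (hx _ (key ha h₁)) (hx' _ (key hb h₂)) ha.le hb.le hab
    rwa [smul_inv_smul₀ ha.ne', smul_inv_smul₀ hb.ne'] at this
  exact fun x hx => convexHull_min (fun x hx y hy => subset_convexHull ℝ s (hs x hx y hy)) hc hx

theorem IsSolidSet.zero_mem {V : Type*} [AddCommGroup V] [Lattice V] [IsOrderedAddMonoid V] {s : Set V} (hs : IsSolidSet s) (hne : s.Nonempty) : (0 : V) ∈ s := by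
  obtain ⟨x, hx⟩ := hne
  exact hs x hx 0 (by simp)

theorem IsSolidSet.balanced {s : Set V} (hs : IsSolidSet s) : Balanced ℝ s := by
  rintro a ha _ ⟨x, hx, rfl⟩
  refine hs x hx _ ?_
  change |a • x| ≤ |x|
  rw [abs_smul_eq]
  exact (smul_le_smul_right_of_nonneg ha (abs_nonneg x)).trans (one_smul ℝ _).le

theorem IsSolidSet.smul {s : Set V} (hs : IsSolidSet s) {c : ℝ} {x y : V}
    (hx : c⁻¹ • x ∈ s) (hy : |y| ≤ |x|) : c⁻¹ • y ∈ s := by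
  refine hs _ hx _ ?_
  rw [abs_smul_eq, abs_smul_eq]
  exact smul_le_smul_of_nonneg_left hy (abs_nonneg _)

end VectorLattice

/-! ### The unit ball of the conjugate sequence space. -/

section DualBall

theorem mem_dualBall_iff_of_eq_top {q : ℝ≥0∞} (h : q.conjExponent = ⊤) {n : ℕ} {a : Fin n → ℝ} :
    a ∈ dualBall q n ↔ ∀ i, |a i| ≤ 1 := by
  change ‖WithLp.toLp q.conjExponent a‖ ≤ 1 ↔ _
  rw [h, PiLp.norm_toLp, pi_norm_le_iff_of_nonneg zero_le_one]
  rfl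

theorem one_le_conjExponent (q : ℝ≥0∞) : 1 ≤ q.conjExponent := le_self_add

theorem conjExponent_toReal_pos {q : ℝ≥0∞} (h : q.conjExponent ≠ ⊤) :
    0 < q.conjExponent.toReal :=
  ENNReal.toReal_pos (zero_lt_one.trans_le (one_le_conjExponent q)).ne' h

theorem mem_dualBall_iff_of_ne_top {q : ℝ≥0∞} (h : q.conjExponent ≠ ⊤) {n : ℕ} {a : Fin n → ℝ} :
    a ∈ dualBall q n ↔ ∑ i, |a i| ^ q.conjExponent.toReal ≤ 1 := by
  change ‖WithLp.toLp q.conjExponent a‖ ≤ 1 ↔ _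
  have hpos := conjExponent_toReal_pos h
  rw [PiLp.norm_eq_sum hpos]
  have h0 : 0 ≤ ∑ i, |a i| ^ q.conjExponent.toReal := Finset.sum_nonneg fun i _ => by positivity
  simp only [Real.norm_eq_abs]
  refine ⟨fun h1 => ?_, fun h1 => Real.rpow_le_one h0 h1 (by positivity)⟩
  by_contra h2
  exact absurd h1 (not_le.2 (Real.one_lt_rpow (not_le.1 h2) (by positivity)))

theorem mem_dualBall_of_abs_le {q : ℝ≥0∞} {n : ℕ} {a b : Fin n → ℝ} (hb : b ∈ dualBall q n)
    (h : ∀ i, |a i| ≤ |b i|) : a ∈ dualBall q n := by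
  by_cases hT : q.conjExponent = ⊤
  · rw [mem_dualBall_iff_of_eq_top hT] at *
    exact fun i => (h i).trans (hb i)
  · rw [mem_dualBall_iff_of_ne_top hT] at *
    refine le_trans (Finset.sum_le_sum fun i _ => ?_) hb
    exact Real.rpow_le_rpow (abs_nonneg _) (h i) ENNReal.toReal_nonneg

theorem single_mem_dualBall (q : ℝ≥0∞) {n : ℕ} (i : Fin n) {c : ℝ} (hc : |c| ≤ 1) :
    Pi.single i c ∈ dualBall q n := by
  by_cases hT : q.conjExponent = ⊤
  · rw [mem_dualBall_iff_of_eq_top hT]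
    intro j
    by_cases hj : j = i
    · subst hj; simpa
    · simp [hj]
  · rw [mem_dualBall_iff_of_ne_top hT, Finset.sum_eq_single i]
    · rw [Pi.single_eq_same]
      exact Real.rpow_le_one (abs_nonneg _) hc ENNReal.toReal_nonneg
    · intro j _ hj
      rw [Pi.single_eq_of_ne hj, abs_zero, Real.zero_rpow (conjExponent_toReal_pos hT).ne']
    · simp

/-- The dual ball is stable under concatenation of weighted families. -/
theorem concat_mem_dualBall {q : ℝ≥0∞} {m : ℕ} {k : Fin m → ℕ} {a : Fin m → ℝ}
    (ha : a ∈ dualBall q m) {b : ∀ i, Fin (k i) → ℝ} (hb : ∀ i, b i ∈ dualBall q (k i)) {N : ℕ}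
    (e : (Σ i, Fin (k i)) ≃ Fin N) :
    (fun l => a (e.symm l).1 * b (e.symm l).1 (e.symm l).2) ∈ dualBall q N := by
  by_cases hT : q.conjExponent = ⊤
  · rw [mem_dualBall_iff_of_eq_top hT] at ha ⊢
    intro l
    rw [abs_mul]
    exact mul_le_one₀ (ha _) (abs_nonneg _) ((mem_dualBall_iff_of_eq_top hT).1 (hb _) _)
  · rw [mem_dualBall_iff_of_ne_top hT] at ha ⊢
    rw [e.symm.sum_comp fun σ => |a σ.1 * b σ.1 σ.2| ^ q.conjExponent.toReal, Fintype.sum_sigma]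
    refine le_trans (Finset.sum_le_sum fun i _ => ?_) ha
    simp only [abs_mul]
    rw [Finset.sum_congr rfl fun j _ => Real.mul_rpow (abs_nonneg _) (abs_nonneg _),
      ← Finset.mul_sum]
    exact mul_le_of_le_one_right (by positivity) ((mem_dualBall_iff_of_ne_top hT).1 (hb i))

end DualBall

/-! ### Sublinearity, continuity and concatenation for `lpSum`. -/

section LpSumFacts

variable {X : Type*} [NormedAddCommGroup X] [NormedSpace ℝ X] [Lattice X] [IsBanachLattice X]

theorem sum_smul_le_lpSum (q : ℝ≥0∞) {n : ℕ} (x : Fin n → X) {a : Fin n → ℝ}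
    (ha : a ∈ dualBall q n) : ∑ i, a i • x i ≤ lpSum q x :=
  (isLUB_lpSum q x).1 ⟨a, ha, rfl⟩

theorem lpSum_le {q : ℝ≥0∞} {n : ℕ} {x : Fin n → X} {z : X}
    (h : ∀ a ∈ dualBall q n, ∑ i, a i • x i ≤ z) : lpSum q x ≤ z :=
  (isLUB_lpSum q x).2 (by rintro _ ⟨a, ha, rfl⟩; exact h a ha)

/-- Each summand is the supremum of the pair `± a i • x i`, and independent sign changes keep the
coefficients in the dual ball. -/
theorem sum_smul_abs_le_lpSum (q : ℝ≥0∞) {n : ℕ} (x : Fin n → X) {a : Fin n → ℝ}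
    (ha : a ∈ dualBall q n) : ∑ i, |a i| • |x i| ≤ lpSum q x := by
  refine sum_le_of_isLUB (fun i => {a i • x i, -(a i • x i)}) _ (fun i => ?_) fun y hy => ?_
  · rw [← abs_smul_eq]
    exact isLUB_pair
  · have : ∀ i, ∃ c : ℝ, |c| ≤ |a i| ∧ y i = c • x i := by
      intro i
      rcases hy i with h | h
      · exact ⟨a i, le_rfl, h⟩
      · exact ⟨-a i, (abs_neg _).le, by rw [neg_smul]; exact h⟩
    choose c hc hyc using this
    simp only [hyc]
    exact sum_smul_le_lpSum q x (mem_dualBall_of_abs_le ha hc)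

theorem lpSum_nonneg (q : ℝ≥0∞) {n : ℕ} (x : Fin n → X) : 0 ≤ lpSum q x := by
  simpa using sum_smul_le_lpSum q x (zero_mem_dualBall q n)

theorem abs_le_lpSum (q : ℝ≥0∞) {n : ℕ} (x : Fin n → X) (i : Fin n) : |x i| ≤ lpSum q x := by
  have := sum_smul_abs_le_lpSum q x (single_mem_dualBall q i (c := 1) (by simp))
  rwa [Finset.sum_eq_single i (fun j _ hj => by simp [hj]) (by simp), Pi.single_eq_same, abs_one,
    one_smul] at this

theorem lpSum_le_sum_abs (q : ℝ≥0∞) {n : ℕ} (x : Fin n → X) : lpSum q x ≤ ∑ i, |x i| :=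
  lpSum_le fun a ha => Finset.sum_le_sum fun i _ => (smul_le_abs_smul_abs _ _).trans <| by
    have := smul_le_smul_right_of_nonneg (abs_le_one_of_mem_dualBall ha i) (abs_nonneg (x i))
    rwa [one_smul] at this

theorem lpSum_one {n : ℕ} (x : Fin n → X) : lpSum 1 x = ∑ i, |x i| := by
  refine le_antisymm (lpSum_le_sum_abs 1 x) ?_
  have h : (fun _ => 1 : Fin n → ℝ) ∈ dualBall 1 n := by
    rw [mem_dualBall_iff_of_eq_top (by simp [ENNReal.conjExponent])]
    simp
  simpa using sum_smul_abs_le_lpSum 1 x h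

theorem lpSum_add_le (q : ℝ≥0∞) {n : ℕ} (x y : Fin n → X) :
    lpSum q (x + y) ≤ lpSum q x + lpSum q y := by
  refine lpSum_le fun a ha => ?_
  simp only [Pi.add_apply, smul_add, Finset.sum_add_distrib]
  exact add_le_add (sum_smul_le_lpSum q x ha) (sum_smul_le_lpSum q y ha)

theorem lpSum_smul (q : ℝ≥0∞) {n : ℕ} {c : ℝ} (hc : 0 ≤ c) (x : Fin n → X) :
    lpSum q (c • x) = c • lpSum q x := by
  have key : ∀ (c : ℝ), 0 ≤ c → ∀ x : Fin n → X, lpSum q (c • x) ≤ c • lpSum q x := by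
    intro c hc x
    refine lpSum_le fun a ha => ?_
    simp only [Pi.smul_apply, smul_comm _ c, ← Finset.smul_sum]
    exact smul_le_smul_of_nonneg_left (sum_smul_le_lpSum q x ha) hc
  refine le_antisymm (key c hc x) ?_
  rcases hc.eq_or_lt with rfl | hc
  · simpa using lpSum_nonneg q (0 : Fin n → X)
  · have := smul_le_smul_of_nonneg_left (key c⁻¹ (inv_nonneg.2 hc.le) (c • x)) hc.le
    rwa [inv_smul_smul₀ hc.ne', smul_inv_smul₀ hc.ne'] at this

theorem abs_lpSum_sub_le (q : ℝ≥0∞) {n : ℕ} (x y : Fin n → X) :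
    |lpSum q x - lpSum q y| ≤ ∑ i, |x i - y i| := by
  have key : ∀ x y : Fin n → X, lpSum q x - lpSum q y ≤ ∑ i, |x i - y i| := by
    intro x y
    rw [sub_le_iff_le_add]
    calc lpSum q x = lpSum q ((x - y) + y) := by rw [sub_add_cancel]
      _ ≤ lpSum q (x - y) + lpSum q y := lpSum_add_le q _ _
      _ ≤ _ := by gcongr; exact lpSum_le_sum_abs q (x - y)
  refine abs_le'.2 ⟨key x y, ?_⟩
  rw [neg_sub]
  refine (key y x).trans (Finset.sum_le_sum fun i _ => ?_)
  rw [abs_sub_comm]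

/-- Subadditivity and domination by `∑ |xᵢ|` give a Lipschitz bound. Continuity is what later moves
estimates to closures and completions. -/
theorem continuous_lpSum (q : ℝ≥0∞) (n : ℕ) : Continuous fun x : Fin n → X => lpSum q x := by
  have h : ∀ x y : Fin n → X, dist (lpSum q x) (lpSum q y) ≤ ∑ i, ‖x i - y i‖ := by
    intro x y
    rw [dist_eq_norm]
    have hn : (0 : X) ≤ ∑ i, |x i - y i| := Finset.sum_nonneg fun i _ => abs_nonneg _
    calc ‖lpSum q x - lpSum q y‖ ≤ ‖∑ i, |x i - y i|‖ :=
          norm_le_norm_of_abs_le_abs (by rw [abs_of_nonneg hn]; exact abs_lpSum_sub_le q x y)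
      _ ≤ ∑ i, ‖|x i - y i|‖ := norm_sum_le _ _
      _ = _ := by simp only [norm_abs_eq_norm]
  rw [continuous_iff_continuousAt]
  intro y
  rw [ContinuousAt, tendsto_iff_dist_tendsto_zero]
  refine squeeze_zero (fun _ => dist_nonneg) (fun x => h x y) ?_
  have : Continuous fun x : Fin n → X => ∑ i, ‖x i - y i‖ := by fun_prop
  simpa using this.tendsto y

theorem norm_le_norm_of_nonneg_of_le {x y : X} (hx : 0 ≤ x) (h : x ≤ y) : ‖x‖ ≤ ‖y‖ :=
  norm_le_norm_of_abs_le_abs (by rwa [abs_of_nonneg hx, abs_of_nonneg (hx.trans h)])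

/-- Iterated `lpSum`s are dominated by the `lpSum` of the concatenated family. -/
theorem lpSum_smul_le_lpSum_concat (q : ℝ≥0∞) {m : ℕ} {k : Fin m → ℕ} {c : Fin m → ℝ}
    (hc : ∀ i, 0 ≤ c i) (y : Fin m → X) (x : ∀ i, Fin (k i) → X)
    (h : ∀ i, |y i| ≤ lpSum q (x i)) {N : ℕ} (e : (Σ i, Fin (k i)) ≃ Fin N) :
    lpSum q (fun i => c i • y i) ≤
      lpSum q (fun l => c (e.symm l).1 • x (e.symm l).1 (e.symm l).2) := by
  refine lpSum_le fun a ha => ?_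
  calc ∑ i, a i • c i • y i ≤ ∑ i, (|a i| * c i) • lpSum q (x i) := by
        refine Finset.sum_le_sum fun i _ => ?_
        rw [smul_smul]
        refine (smul_le_abs_smul_abs _ _).trans ?_
        rw [abs_mul, abs_of_nonneg (hc i)]
        exact smul_le_smul_of_nonneg_left (h i) (mul_nonneg (abs_nonneg _) (hc i))
    _ ≤ _ := ?_
  -- Each inner `lpSum` is a supremum over its own dual ball, so it suffices to bound all
  -- simultaneous choices `b i`; together with `|a|` these form one coefficient vector for the
  -- concatenated family.
  refine sum_le_of_isLUB
    (fun i => (fun b => (|a i| * c i) • ∑ j, b j • x i j) '' dualBall q (k i)) _ (fun i => ?_)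
    fun w hw => ?_
  · have hac : 0 ≤ |a i| * c i := mul_nonneg (abs_nonneg _) (hc i)
    have := isLUB_lpSum q ((|a i| * c i) • x i)
    rw [lpSum_smul q hac] at this
    convert this using 3 with b
    rw [Finset.smul_sum]
    exact Finset.sum_congr rfl fun j _ => smul_comm _ _ _
  · choose b hb hbw using hw
    have := sum_smul_le_lpSum q (fun l => c (e.symm l).1 • x (e.symm l).1 (e.symm l).2)
      (concat_mem_dualBall (mem_dualBall_of_abs_le ha (a := fun i => |a i|) (by simp)) hb e)
    refine le_trans (le_of_eq ?_) this
    rw [e.symm.sum_comp fun σ => (|a σ.1| * b σ.1 σ.2) • c σ.1 • x σ.1 σ.2, Fintype.sum_sigma]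
    refine Finset.sum_congr rfl fun i _ => ?_
    rw [← hbw i]
    simp only [Finset.smul_sum]
    refine Finset.sum_congr rfl fun j _ => ?_
    simp only [smul_smul]
    congr 1
    ring

end LpSumFacts

/-! ### Completion of a solidly seminormed vector lattice. -/

section Completion

open UniformSpace

variable {V : Type u} [SeminormedAddCommGroup V] [NormedSpace ℝ V] [Lattice V]
  [IsOrderedAddMonoid V] [PosSMulMono ℝ V]

theorem uniformContinuous₂_of_norm_sub_le {V : Type*} [SeminormedAddCommGroup V] {f : V → V → V}
    (h : ∀ a b c d, ‖f a b - f c d‖ ≤ ‖a - c‖ + ‖b - d‖) : UniformContinuous₂ f := by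
  rw [UniformContinuous₂, Metric.uniformContinuous_iff]
  intro ε hε
  refine ⟨ε / 2, half_pos hε, ?_⟩
  rintro ⟨a, b⟩ ⟨c, d⟩ hab
  obtain ⟨h1, h2⟩ := max_lt_iff.1 hab
  simp only [dist_eq_norm] at h1 h2
  calc dist (f a b) (f c d) ≤ ‖a - c‖ + ‖b - d‖ := by rw [dist_eq_norm]; exact h a b c d
    _ < ε := by linarith

/-- Changing one argument at a time uses `|a ⊔ b - c ⊔ b| ≤ |a - c|`. The resulting uniform
continuity lets the lattice operations extend to the completion. -/
theorem norm_sup_sub_sup_le_of_solid {V : Type*} [SeminormedAddCommGroup V] [Lattice V]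
    [IsOrderedAddMonoid V] (hs : ∀ x y : V, |x| ≤ |y| → ‖x‖ ≤ ‖y‖) (a b c d : V) :
    ‖a ⊔ b - c ⊔ d‖ ≤ ‖a - c‖ + ‖b - d‖ := by
  have habs : ∀ x : V, ‖|x|‖ = ‖x‖ := fun x =>
    (hs _ _ (abs_abs x).le).antisymm (hs _ _ (abs_abs x).symm.le)
  rw [← habs (a - c), ← habs (b - d)]
  refine le_trans (hs _ _ ?_) (norm_add_le |a - c| |b - d|)
  rw [abs_of_nonneg (add_nonneg (abs_nonneg (a - c)) (abs_nonneg (b - d)))]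
  calc |a ⊔ b - c ⊔ d| = |a ⊔ b - c ⊔ b + (c ⊔ b - c ⊔ d)| := by rw [sub_add_sub_cancel]
    _ ≤ |a ⊔ b - c ⊔ b| + |c ⊔ b - c ⊔ d| := abs_add_le _ _
    _ ≤ |a - c| + |b - d| := by
      gcongr ?_ + ?_
      · exact abs_sup_sub_sup_le_abs _ _ _
      · rw [sup_comm c, sup_comm c]
        exact abs_sup_sub_sup_le_abs _ _ _

theorem norm_inf_sub_inf_le_of_solid {V : Type*} [SeminormedAddCommGroup V] [Lattice V]
    [IsOrderedAddMonoid V] (hs : ∀ x y : V, |x| ≤ |y| → ‖x‖ ≤ ‖y‖) (a b c d : V) :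
    ‖a ⊓ b - c ⊓ d‖ ≤ ‖a - c‖ + ‖b - d‖ := by
  have h := norm_sup_sub_sup_le_of_solid hs (-a) (-b) (-c) (-d)
  rw [← neg_inf, ← neg_inf, ← neg_sub', norm_neg, ← neg_sub', norm_neg, ← neg_sub', norm_neg] at h
  exact h

/-- The completion of a vector lattice with a solid seminorm is a Banach lattice. -/
theorem exists_banachLattice_completion (hs : ∀ x y : V, |x| ≤ |y| → ‖x‖ ≤ ‖y‖) :
    ∃ (_ : Lattice (Completion V)) (_ : IsBanachLattice (Completion V)),
      ∀ x y : V, ((x ⊔ y : V) : Completion V) = ↑x ⊔ ↑y ∧ ((x ⊓ y : V) : Completion V) = ↑x ⊓ ↑y := by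
  have hsup := uniformContinuous₂_of_norm_sub_le (norm_sup_sub_sup_le_of_solid hs)
  have hinf := uniformContinuous₂_of_norm_sub_le (norm_inf_sub_inf_le_of_solid hs)
  let : Max (Completion V) := ⟨Completion.map₂ (· ⊔ ·)⟩
  let : Min (Completion V) := ⟨Completion.map₂ (· ⊓ ·)⟩
  have csup : ∀ x y : V, ((x ⊔ y : V) : Completion V) = ↑x ⊔ ↑y := fun x y =>
    (Completion.map₂_coe_coe x y _ hsup).symm
  have cinf : ∀ x y : V, ((x ⊓ y : V) : Completion V) = ↑x ⊓ ↑y := fun x y =>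
    (Completion.map₂_coe_coe x y _ hinf).symm
  have : ContinuousSup (Completion V) :=
    ⟨Completion.continuous_map₂ continuous_fst continuous_snd⟩
  have : ContinuousInf (Completion V) :=
    ⟨Completion.continuous_map₂ continuous_fst continuous_snd⟩
  have hadd : ∀ a b c : Completion V, (a ⊔ b) + c = (a + c) ⊔ (b + c) := fun a b c =>
    Completion.induction_on₃ a b c (isClosed_eq (by fun_prop) (by fun_prop)) fun a b c => by
      rw [← csup, ← Completion.coe_add, ← Completion.coe_add, ← Completion.coe_add, ← csup, sup_add]
  have hsmul : ∀ (t : ℝ), 0 ≤ t → ∀ a b : Completion V, t • (a ⊔ b) = t • a ⊔ t • b :=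
    fun t ht a b =>
    Completion.induction_on₂ a b (isClosed_eq ((continuous_fst.sup continuous_snd).const_smul t)
      ((continuous_fst.const_smul t).sup (continuous_snd.const_smul t))) fun a b => by
      rw [← csup, ← Completion.coe_smul, ← Completion.coe_smul, ← Completion.coe_smul, ← csup,
        smul_sup_of_nonneg ht]
  -- The lattice axioms are equations between continuous maps, so they pass from the dense image.
  -- The order is defined through `⊔`, and order axioms are checked as identities in `⊔`.
  let L : Lattice (Completion V) := Lattice.mk'
    (fun a b => Completion.induction_on₂ a b (isClosed_eq (by fun_prop) (by fun_prop))
      fun a b => by rw [← csup, ← csup, sup_comm])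
    (fun a b c => Completion.induction_on₃ a b c (isClosed_eq (by fun_prop) (by fun_prop))
      fun a b c => by simp only [← csup, sup_assoc])
    (fun a b => Completion.induction_on₂ a b (isClosed_eq (by fun_prop) (by fun_prop))
      fun a b => by rw [← cinf, ← cinf, inf_comm])
    (fun a b c => Completion.induction_on₃ a b c (isClosed_eq (by fun_prop) (by fun_prop))
      fun a b c => by simp only [← cinf, inf_assoc])
    (fun a b => Completion.induction_on₂ a b (isClosed_eq (by fun_prop) (by fun_prop))
      fun a b => by rw [← cinf, ← csup, sup_inf_self])
    (fun a b => Completion.induction_on₂ a b (isClosed_eq (by fun_prop) (by fun_prop))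
      fun a b => by rw [← csup, ← cinf, inf_sup_self])
  have ccont : ContinuousSup (Completion V) := ‹_›
  have csup' : ∀ x y : V, ((x ⊔ y : V) : Completion V) = ↑x ⊔ ↑y := csup
  have cabs : ∀ x : V, |(x : Completion V)| = ((|x| : V) : Completion V) := fun x => by
    rw [abs, abs, csup', Completion.coe_neg]
  have habs : ∀ a : Completion V, ‖|a|‖ = ‖a‖ := fun a =>
    Completion.induction_on a (isClosed_eq (by unfold abs; fun_prop) (by fun_prop)) fun x => by
      rw [cabs, Completion.norm_coe, Completion.norm_coe]
      exact (hs _ _ (abs_abs x).le).antisymm (hs _ _ (abs_abs x).symm.le)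
  -- This is solidity without its premise `|a| ≤ |b|`: an unconditional closed inequality, to which
  -- density applies, and which reduces to solidity once `|a| ⊔ |b| = |b|`.
  have hle : ∀ a b : Completion V, ‖|a|‖ ≤ ‖|a| ⊔ |b|‖ := fun a b =>
    Completion.induction_on₂ a b (isClosed_le (by unfold abs; fun_prop) (by unfold abs; fun_prop))
      fun x y => by
      rw [cabs, cabs, ← csup', Completion.norm_coe, Completion.norm_coe]
      refine hs _ _ ?_
      rw [abs_abs, abs_of_nonneg ((abs_nonneg x).trans le_sup_left)]
      exact le_sup_left
  refine ⟨L, ?_, fun x y => ⟨csup x y, cinf x y⟩⟩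
  exact
    { add_le_add_left := fun a b h c => by
        rw [← sup_eq_right] at h ⊢
        rw [← hadd, h]
      smul_le_smul_of_nonneg_left := fun t ht a b h => by
        change t • a ≤ t • b
        rw [← sup_eq_right] at h ⊢
        rw [← hsmul t ht, h]
      solid := fun a b h => by
        rw [← habs a, ← habs b, ← sup_eq_right.2 h]
        exact hle a b }

end Completion

/-! ### Banach lattices from solid seminorms and norms. -/

section Renorming

variable {V : Type u} [AddCommGroup V] [Module ℝ V] [Lattice V] [IsOrderedAddMonoid V]
  [PosSMulMono ℝ V]

/-- The Banach lattice obtained from a solid seminorm by separation and completion. -/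
theorem exists_banachLattice_of_solid_seminorm (N : Seminorm ℝ V)
    (hN : ∀ x y : V, |x| ≤ |y| → N x ≤ N y) :
    ∃ (W : Type u) (_ : NormedAddCommGroup W) (_ : NormedSpace ℝ W) (_ : Lattice W)
      (_ : IsBanachLattice W) (ψ : V →ₗ[ℝ] W), (∀ x, ‖ψ x‖ = N x) ∧ DenseRange ψ ∧
      ∀ x y, ψ (x ⊔ y) = ψ x ⊔ ψ y ∧ ψ (x ⊓ y) = ψ x ⊓ ψ y := by
  let : SeminormedAddCommGroup V := N.toAddGroupSeminorm.toSeminormedAddCommGroup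
  let : NormedSpace ℝ V := ⟨fun a x => (map_smul_eq_mul N a x).le⟩
  obtain ⟨L, hL, h⟩ := exists_banachLattice_completion (V := V) hN
  exact ⟨UniformSpace.Completion V, inferInstance, inferInstance, L, hL,
    (UniformSpace.Completion.toComplₗᵢ (𝕜 := ℝ)).toLinearMap,
    fun x => UniformSpace.Completion.norm_coe x, UniformSpace.Completion.denseRange_coe, h⟩

/-- A vector lattice which is complete for a solid norm is a Banach lattice. -/
theorem exists_banachLattice_of_complete_norm (N : Seminorm ℝ V)
    (hN : ∀ x y : V, |x| ≤ |y| → N x ≤ N y) (hN0 : ∀ x, N x = 0 → x = 0)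
    (hc : ∀ z : ℕ → V, (∀ ε > 0, ∃ M, ∀ m ≥ M, ∀ n ≥ M, N (z m - z n) < ε) →
      ∃ x, ∀ ε > 0, ∃ M, ∀ n ≥ M, N (z n - x) < ε) :
    ∃ (Z : Type u) (_ : NormedAddCommGroup Z) (_ : NormedSpace ℝ Z) (_ : Lattice Z)
      (_ : IsBanachLattice Z) (e : V ≃ₗ[ℝ] Z), (∀ x, ‖e x‖ = N x) ∧
      ∀ x y, e (x ⊔ y) = e x ⊔ e y ∧ e (x ⊓ y) = e x ⊓ e y := by
  let : NormedAddCommGroup V :=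
    AddGroupNorm.toNormedAddCommGroup { N.toAddGroupSeminorm with eq_zero_of_map_eq_zero' := hN0 }
  let : NormedSpace ℝ V := ⟨fun a x => (map_smul_eq_mul N a x).le⟩
  have hnorm : ∀ x : V, ‖x‖ = N x := fun _ => rfl
  have : HasSolidNorm V := ⟨hN⟩
  have : CompleteSpace V := by
    refine Metric.complete_of_cauchySeq_tendsto fun z hz => ?_
    rw [Metric.cauchySeq_iff] at hz
    simp only [dist_eq_norm, hnorm] at hz
    obtain ⟨x, hx⟩ := hc z hz
    exact ⟨x, Metric.tendsto_atTop.2 (by simpa only [dist_eq_norm, hnorm] using hx)⟩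
  exact ⟨V, inferInstance, inferInstance, inferInstance, {}, LinearEquiv.refl ℝ V, hnorm,
    fun x y => ⟨rfl, rfl⟩⟩

end Renorming

/-! ### Order ideals with a prescribed closed unit ball. -/

section Ideal

variable {Y : Type v} [NormedAddCommGroup Y] [NormedSpace ℝ Y] [Lattice Y] [IsBanachLattice Y]

theorem inv_smul_mem_of_le {V : Type*} [AddCommGroup V] [Module ℝ V] {C : Set V}
    (hC : Balanced ℝ C) {s t : ℝ} (hs : 0 < s) (hst : s ≤ t) {x : V} (hx : s⁻¹ • x ∈ C) :
    t⁻¹ • x ∈ C := by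
  have ht := hs.trans_le hst
  have h := hC.smul_mem (a := s / t) (by
    rw [Real.norm_eq_abs, abs_of_pos (div_pos hs ht)]; exact (div_le_one ht).2 hst) hx
  rwa [smul_smul, div_mul_eq_mul_div, mul_inv_cancel₀ hs.ne', one_div] at h

/-- The order ideal spanned by a convex solid set. -/
def idealSpan (C : Set Y) (hconv : Convex ℝ C) (hsol : IsSolidSet C) (hne : C.Nonempty) :
    Submodule ℝ Y where
  carrier := {y | ∃ t : ℝ, 0 < t ∧ t⁻¹ • y ∈ C}
  zero_mem' := ⟨1, one_pos, by simpa using hsol.zero_mem hne⟩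
  add_mem' := by
    rintro x y ⟨t, ht, hx⟩ ⟨s, hs, hy⟩
    refine ⟨t + s, by positivity, ?_⟩
    have h := hconv hx hy (a := t / (t + s)) (b := s / (t + s)) (by positivity) (by positivity)
      (by field_simp)
    rw [smul_smul, smul_smul] at h
    convert h using 1
    rw [smul_add]
    congr 2 <;> field_simp
  smul_mem' := by
    rintro c x ⟨t, ht, hx⟩
    refine ⟨t * (|c| + 1), by positivity, ?_⟩
    have h := hsol.balanced.smul_mem (a := c / (|c| + 1)) (by
      rw [norm_div, Real.norm_eq_abs, Real.norm_eq_abs, abs_of_pos (by positivity : 0 < |c| + 1)]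
      exact (div_le_one (by positivity)).2 (by linarith)) hx
    rw [smul_smul] at h ⊢
    convert h using 2
    field_simp

theorem idealSpan_solid {C : Set Y} (hconv : Convex ℝ C) (hsol : IsSolidSet C)
    (hne : C.Nonempty) : IsSolidSet (idealSpan C hconv hsol hne : Set Y) := by
  rintro x ⟨t, ht, hx⟩ y hy
  exact ⟨t, ht, hsol.smul hx hy⟩

theorem IsSolidSet.sup_mem {I : Submodule ℝ Y} (hI : IsSolidSet (I : Set Y)) {x y : Y}
    (hx : x ∈ I) (hy : y ∈ I) : x ⊔ y ∈ I := by
  have habs : ∀ z ∈ I, |z| ∈ I := fun z hz => hI z hz _ (abs_abs z).le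
  refine hI _ (I.add_mem (habs x hx) (habs y hy)) _ ?_
  rw [abs_of_nonneg (add_nonneg (abs_nonneg x) (abs_nonneg y))]
  refine abs_le'.2 ⟨sup_le ?_ ?_, ?_⟩
  · exact (le_abs_self x).trans (le_add_of_nonneg_right (abs_nonneg y))
  · exact (le_abs_self y).trans (le_add_of_nonneg_left (abs_nonneg x))
  · exact (neg_le_neg le_sup_left).trans ((neg_le_abs x).trans
      (le_add_of_nonneg_right (abs_nonneg y)))

theorem IsSolidSet.inf_mem {I : Submodule ℝ Y} (hI : IsSolidSet (I : Set Y)) {x y : Y}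
    (hx : x ∈ I) (hy : y ∈ I) : x ⊓ y ∈ I := by
  have := I.neg_mem (hI.sup_mem (I.neg_mem hx) (I.neg_mem hy))
  rwa [← neg_inf, neg_neg] at this

/-- A closed bounded convex solid set `C` of a Banach lattice `Y` is the unit ball of a Banach
lattice which is an order ideal of `Y`. -/
theorem exists_banachLattice_ideal {C : Set Y} (hconv : Convex ℝ C) (hsol : IsSolidSet C)
    (hne : C.Nonempty) (hclosed : IsClosed C) {K : ℝ} (hK : ∀ c ∈ C, ‖c‖ ≤ K) :
    ∃ (Z : Type v) (_ : NormedAddCommGroup Z) (_ : NormedSpace ℝ Z) (_ : Lattice Z)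
      (_ : IsBanachLattice Z) (Φ : Z →L[ℝ] Y), IsLatticeHom Φ ∧ Function.Injective Φ ∧
      (∀ z y, |y| ≤ |Φ z| → ∃ z', Φ z' = y) ∧
      (∀ z t, 0 < t → (‖z‖ ≤ t ↔ t⁻¹ • Φ z ∈ C)) ∧
      ∀ y ∈ C, ∃ z, Φ z = y := by
  set I := idealSpan C hconv hsol hne with hI
  have hIs : IsSolidSet (I : Set Y) := idealSpan_solid hconv hsol hne
  have hbal := hsol.balanced
  have hK0 : 0 ≤ K := by
    obtain ⟨c, hc⟩ := hne
    exact (norm_nonneg c).trans (hK c hc)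
  let L : Lattice I := Subtype.lattice (P := fun y => y ∈ I) (fun _ _ hx hy => hIs.sup_mem hx hy)
    (fun _ _ hx hy => hIs.inf_mem hx hy)
  have hle : ∀ x y : I, x ≤ y ↔ (x : Y) ≤ y := fun _ _ => Iff.rfl
  have hoam : IsOrderedAddMonoid I :=
    { add_le_add_left := fun a b h c => by
        rw [hle] at h ⊢
        exact add_le_add_left h (c : Y) }
  have hpos : PosSMulMono ℝ I := ⟨fun t ht a b h => by
    rw [hle] at h ⊢
    exact smul_le_smul_of_nonneg_left h ht⟩
  have habs : ∀ x : I, ((|x| : I) : Y) = |(x : Y)| := fun _ => rfl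
  let s : Set I := Subtype.val ⁻¹' C
  have hs_bal : Balanced ℝ s := by
    rintro a ha _ ⟨x, hx, rfl⟩
    exact hbal.smul_mem ha hx
  have hs_conv : Convex ℝ s := hconv.linear_preimage I.subtype
  have hs_abs : Absorbent ℝ s := by
    rintro ⟨x, t, ht, hx⟩
    refine Absorbs.of_norm ⟨t, fun c hc => ?_⟩
    have hc0 : c ≠ 0 := by rintro rfl; simp at hc; linarith
    rintro _ rfl
    rw [Set.mem_smul_set_iff_inv_smul_mem₀ hc0]
    have := inv_smul_mem_of_le hbal ht hc hx
    have h2 := hbal.smul_mem (a := c⁻¹ * |c|) (by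
      rw [norm_mul, norm_inv, Real.norm_eq_abs, Real.norm_eq_abs, abs_abs,
        inv_mul_cancel₀ (abs_pos.2 hc0).ne']) this
    rw [smul_smul, Real.norm_eq_abs, mul_assoc, mul_inv_cancel₀ (abs_pos.2 hc0).ne',
      mul_one] at h2
    exact h2
  let N : Seminorm ℝ I := gaugeSeminorm hs_bal hs_conv hs_abs
  -- The gauge only gives membership at `t + ε`; closedness of `C` permits `ε → 0`, so `C` is
  -- exactly the closed unit ball.
  have hNle : ∀ (x : I) (t : ℝ), 0 < t → (N x ≤ t ↔ t⁻¹ • (x : Y) ∈ C) := by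
    intro x t ht
    constructor
    · intro h
      have h1 : ∀ ε : ℝ, 0 < ε → (t + ε)⁻¹ • (x : Y) ∈ C := by
        intro ε hε
        obtain ⟨b, hb, hbt, hxb⟩ := exists_lt_of_gauge_lt hs_abs
          (show gauge s x < t + ε from lt_of_le_of_lt h (by linarith))
        rw [Set.mem_smul_set_iff_inv_smul_mem₀ hb.ne'] at hxb
        exact inv_smul_mem_of_le hbal hb hbt.le hxb
      have h2 : Filter.Tendsto (fun ε : ℝ => (t + ε)⁻¹ • (x : Y)) (nhdsWithin 0 (Set.Ioi 0))
          (nhds ((t + 0)⁻¹ • (x : Y))) := by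
        refine Filter.Tendsto.mono_left ?_ nhdsWithin_le_nhds
        refine Filter.Tendsto.smul_const (Filter.Tendsto.inv₀ ?_ (by simpa using ht.ne')) _
        exact tendsto_const_nhds.add Filter.tendsto_id
      rw [add_zero] at h2
      exact hclosed.mem_of_tendsto h2 (by
        filter_upwards [self_mem_nhdsWithin] with ε hε using h1 ε hε)
    · intro h
      refine gauge_le_of_mem ht.le ?_
      rw [Set.mem_smul_set_iff_inv_smul_mem₀ ht.ne']
      exact h
  have hNY : ∀ x : I, ‖(x : Y)‖ ≤ K * N x := by
    intro x
    have h1 : ∀ ε : ℝ, 0 < ε → ‖(x : Y)‖ ≤ K * (N x + ε) := by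
      intro ε hε
      have ht : 0 < N x + ε := add_pos_of_nonneg_of_pos (apply_nonneg N x) hε
      have := hK _ ((hNle x _ ht).1 (by linarith))
      rwa [norm_smul, norm_inv, Real.norm_eq_abs, abs_of_pos ht, inv_mul_le_iff₀ ht,
        mul_comm] at this
    refine le_of_forall_pos_le_add fun ε hε => ?_
    -- The bound `K` may be `0`, hence the division by `K + 1`.
    have := h1 (ε / (K + 1)) (by positivity)
    rw [mul_add] at this
    refine this.trans (add_le_add le_rfl ?_)
    rw [mul_div_assoc', div_le_iff₀ (by positivity)]
    nlinarith
  have hNsolid : ∀ x y : I, |x| ≤ |y| → N x ≤ N y := by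
    intro x y hxy
    rw [hle, habs, habs] at hxy
    refine le_of_forall_pos_le_add fun ε hε => ?_
    have ht : 0 < N y + ε := add_pos_of_nonneg_of_pos (apply_nonneg N y) hε
    exact (hNle x _ ht).2 (hsol.smul ((hNle y _ ht).1 (by linarith)) hxy)
  have hN0 : ∀ x, N x = 0 → x = 0 := by
    intro x hx
    have := hNY x
    rw [hx, mul_zero] at this
    exact Subtype.ext (norm_le_zero_iff.1 this)
  have hcomplete : ∀ z : ℕ → I, (∀ ε > 0, ∃ M, ∀ m ≥ M, ∀ n ≥ M, N (z m - z n) < ε) →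
      ∃ x, ∀ ε > 0, ∃ M, ∀ n ≥ M, N (z n - x) < ε := by
    intro z hz
    have hcau : CauchySeq fun n => (z n : Y) := by
      rw [Metric.cauchySeq_iff]
      intro ε hε
      obtain ⟨M, hM⟩ := hz (ε / (K + 1)) (by positivity)
      refine ⟨M, fun m hm n hn => ?_⟩
      rw [dist_eq_norm]
      have h1 := hNY (z m - z n)
      have h2 := hM m hm n hn
      rw [lt_div_iff₀ (by positivity)] at h2
      have h3 := apply_nonneg N (z m - z n)
      calc ‖(z m : Y) - z n‖ ≤ K * N (z m - z n) := h1
        _ < ε := by nlinarith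
    obtain ⟨y, hy⟩ := cauchySeq_tendsto_of_complete hcau
    -- The limit `y` is taken in `Y`; since `C` is closed, letting `n → ∞` in `z m - z n ∈ ε C`
    -- upgrades the convergence to the gauge norm and also puts `y` in the ideal.
    have hlim : ∀ ε : ℝ, 0 < ε → ∃ M, ∀ m ≥ M, ε⁻¹ • ((z m : Y) - y) ∈ C := by
      intro ε hε
      obtain ⟨M, hM⟩ := hz ε hε
      refine ⟨M, fun m hm => ?_⟩
      refine hclosed.mem_of_tendsto ((tendsto_const_nhds.sub hy).const_smul _) ?_
      filter_upwards [Filter.eventually_ge_atTop M] with n hn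
      exact (hNle _ _ hε).1 (hM m hm n hn).le
    have hyI : y ∈ I := by
      obtain ⟨M, hM⟩ := hlim 1 one_pos
      have h1 : (z M : Y) - y ∈ I := ⟨1, one_pos, hM M le_rfl⟩
      have := I.sub_mem (z M).2 h1
      rwa [sub_sub_cancel] at this
    refine ⟨⟨y, hyI⟩, fun ε hε => ?_⟩
    obtain ⟨M, hM⟩ := hlim (ε / 2) (half_pos hε)
    refine ⟨M, fun n hn => lt_of_le_of_lt ((hNle _ _ (half_pos hε)).2 (hM n hn)) (half_lt_self hε)⟩
  obtain ⟨Z, i₁, i₂, i₃, i₄, e, he, hlat⟩ :=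
    exists_banachLattice_of_complete_norm N hNsolid hN0 hcomplete
  have hsymm : ∀ z, N (e.symm z) = ‖z‖ := fun z => by rw [← he, e.apply_symm_apply]
  let Φ : Z →L[ℝ] Y := (I.subtype ∘ₗ e.symm.toLinearMap).mkContinuous K fun z => by
    have h := hNY (e.symm z)
    rw [hsymm] at h
    exact h
  have hΦ : ∀ z, Φ z = (e.symm z : Y) := fun _ => rfl
  have hΦe : ∀ x, Φ (e x) = (x : Y) := fun x => by rw [hΦ, e.symm_apply_apply]
  refine ⟨Z, i₁, i₂, i₃, i₄, Φ, fun z w => ?_, fun z w h => ?_, fun z y hy => ?_,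
    fun z t ht => ?_, fun y hy => ?_⟩
  · obtain ⟨z, rfl⟩ := e.surjective z
    obtain ⟨w, rfl⟩ := e.surjective w
    rw [← (hlat z w).1, ← (hlat z w).2, hΦe, hΦe, hΦe, hΦe]
    exact ⟨rfl, rfl⟩
  · rw [hΦ, hΦ] at h
    exact e.symm.injective (Subtype.ext h)
  · have hyI : y ∈ I := hIs _ (e.symm z).2 y hy
    exact ⟨e ⟨y, hyI⟩, hΦe _⟩
  · rw [← hsymm]
    exact hNle _ t ht
  · have hyI : y ∈ I := ⟨1, one_pos, by simpa using hy⟩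
    exact ⟨e ⟨y, hyI⟩, hΦe _⟩

end Ideal

/-! ### Closures of solid sets. -/

section SolidClosure

variable {Y : Type v} [NormedAddCommGroup Y] [NormedSpace ℝ Y] [Lattice Y] [IsBanachLattice Y]

/-- Truncating `y` to `[-|b|, |b|]` is continuous in `b`, lands in `s` for `b ∈ s`, and returns `y`
at `b = x`. -/
theorem IsSolidSet.closure {s : Set Y} (hs : IsSolidSet s) : IsSolidSet (closure s) := by
  intro x hx y hy
  have hcont : Continuous fun b : Y => (y ⊓ |b|) ⊔ -|b| := by
    unfold abs
    fun_prop
  have hxy : (y ⊓ |x|) ⊔ -|x| = y := by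
    rw [inf_eq_left.2 ((le_abs_self y).trans hy), sup_eq_left.2]
    rw [neg_le]
    exact (neg_le_abs y).trans hy
  rw [← hxy]
  refine map_mem_closure (f := fun b : Y => (y ⊓ |b|) ⊔ -|b|) hcont hx
    fun b hb => hs b hb _ (abs_le'.2 ⟨?_, ?_⟩)
  · exact sup_le inf_le_right (neg_le_self (abs_nonneg b))
  · rw [neg_le]
    exact le_sup_right

end SolidClosure

/-! ### Injective lattice homomorphisms onto order ideals. -/

section LatticeHom

variable {Z : Type u} {Y : Type v} [NormedAddCommGroup Y] [NormedSpace ℝ Y] [Lattice Y]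
  [NormedAddCommGroup Z] [NormedSpace ℝ Z] [Lattice Z]

theorem IsLatticeHom.map_abs {Φ : Z →L[ℝ] Y} (h : IsLatticeHom Φ) (z : Z) : Φ |z| = |Φ z| := by
  rw [abs, abs, (h _ _).1, map_neg]

theorem IsLatticeHom.monotone {Φ : Z →L[ℝ] Y} (h : IsLatticeHom Φ) {z w : Z} (hzw : z ≤ w) :
    Φ z ≤ Φ w := by
  rw [← sup_eq_right] at hzw ⊢
  rw [← (h _ _).1, hzw]

theorem IsLatticeHom.le_of_map_le {Φ : Z →L[ℝ] Y} (h : IsLatticeHom Φ)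
    (hinj : Function.Injective Φ) {z w : Z} (hzw : Φ z ≤ Φ w) : z ≤ w := by
  rw [← sup_eq_right] at hzw ⊢
  exact hinj (by rw [(h _ _).1, hzw])

variable [IsBanachLattice Y] [IsBanachLattice Z]

theorem IsLatticeHom.isIntervalPreserving {Φ : Z →L[ℝ] Y} (h : IsLatticeHom Φ)
    (hinj : Function.Injective Φ) (hideal : ∀ z y, |y| ≤ |Φ z| → ∃ z', Φ z' = y) :
    IsIntervalPreserving Φ := by
  have hpos : ∀ x : Z, 0 ≤ x → 0 ≤ Φ x := fun x hx => by simpa using h.monotone hx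
  refine ⟨hpos, fun x hx => Set.Subset.antisymm ?_ ?_⟩
  · rintro _ ⟨z, ⟨hz0, hzx⟩, rfl⟩
    exact ⟨hpos z hz0, h.monotone hzx⟩
  · rintro y ⟨hy0, hyx⟩
    obtain ⟨z, rfl⟩ := hideal x y (by rwa [abs_of_nonneg hy0, abs_of_nonneg (hpos x hx)])
    exact ⟨z, ⟨h.le_of_map_le hinj (by simpa using hy0), h.le_of_map_le hinj hyx⟩, rfl⟩

/-- The inclusion of an order ideal preserves `lpSum`. -/
theorem IsLatticeHom.map_lpSum {Φ : Z →L[ℝ] Y} (h : IsLatticeHom Φ)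
    (hinj : Function.Injective Φ) (hideal : ∀ z y, |y| ≤ |Φ z| → ∃ z', Φ z' = y) (s : ℝ≥0∞)
    {n : ℕ} (z : Fin n → Z) : Φ (lpSum s z) = lpSum s (fun i => Φ (z i)) := by
  refine le_antisymm ?_ (lpSum_le fun a ha => ?_)
  -- The supremum formed in `Y` is dominated by `Φ (∑ |z i|)`, so it lies in the ideal; its preimage
  -- is an upper bound in `Z`.
  · obtain ⟨w, hw⟩ := hideal (∑ i, |z i|) (lpSum s fun i => Φ (z i)) (by
      rw [abs_of_nonneg (lpSum_nonneg _ _), map_sum]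
      simp only [h.map_abs]
      exact (lpSum_le_sum_abs _ _).trans (le_abs_self _))
    rw [← hw]
    refine h.monotone (lpSum_le fun a ha => h.le_of_map_le hinj ?_)
    rw [hw, map_sum]
    simp only [map_smul]
    exact sum_smul_le_lpSum s _ ha
  · have := h.monotone (sum_smul_le_lpSum s z ha)
    rw [map_sum] at this
    simpa only [map_smul] using this

end LatticeHom

/-! ### Factorization of a convex operator through a convex ideal. -/

section Factorization

theorem norm_toLp_le_iff {r : ℝ≥0∞} (hr : 0 < r.toReal) {n : ℕ} (a : Fin n → ℝ) {t : ℝ}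
    (ht : 0 ≤ t) : ‖WithLp.toLp r a‖ ≤ t ↔ ∑ i, |a i| ^ r.toReal ≤ t ^ r.toReal := by
  rw [PiLp.norm_eq_sum hr]
  have h0 : 0 ≤ ∑ i, |a i| ^ r.toReal := Finset.sum_nonneg fun i _ => by positivity
  have := Real.rpow_le_rpow_iff (z := r.toReal)
    (Real.rpow_nonneg h0 (1 / r.toReal)) ht hr
  rw [← Real.rpow_mul h0, one_div_mul_cancel hr.ne', Real.rpow_one] at this
  simp only [Real.norm_eq_abs]
  exact this.symm

variable {E : Type u} {Y : Type v} [NormedAddCommGroup E] [NormedSpace ℝ E]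
  [NormedAddCommGroup Y] [NormedSpace ℝ Y] [Lattice Y] [IsBanachLattice Y]

/-- The elements dominated by some `lpSum s (S e₁, …, S eₙ)` with `∑ ‖eᵢ‖^r ≤ 1`. -/
def convexGenerators (r s : ℝ≥0∞) (S : E →L[ℝ] Y) : Set Y :=
  {y | ∃ (n : ℕ) (e : Fin n → E), ∑ i, ‖e i‖ ^ r.toReal ≤ 1 ∧ |y| ≤ lpSum s (fun i => S (e i))}

theorem isSolidSet_convexGenerators (r s : ℝ≥0∞) (S : E →L[ℝ] Y) :
    IsSolidSet (convexGenerators r s S) := by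
  rintro x ⟨n, e, he, hx⟩ y hy
  exact ⟨n, e, he, hy.trans hx⟩

theorem map_mem_convexGenerators {r : ℝ≥0∞} (s : ℝ≥0∞) (S : E →L[ℝ] Y) {e : E} (he : ‖e‖ ≤ 1) :
    S e ∈ convexGenerators r s S := by
  refine ⟨1, fun _ => e, ?_, abs_le_lpSum s (fun _ : Fin 1 => S e) 0⟩
  simpa using Real.rpow_le_one (norm_nonneg e) he ENNReal.toReal_nonneg

theorem exists_bound_convexGenerators {r s : ℝ≥0∞} (hr : 0 < r.toReal) {S : E →L[ℝ] Y}
    (hS : IsConvexOperator r s S) : ∃ K : ℝ, ∀ y ∈ convexGenerators r s S, ‖y‖ ≤ K := by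
  obtain ⟨K, hK1, hK⟩ := hS
  refine ⟨K, ?_⟩
  rintro y ⟨n, e, he, hy⟩
  have h1 : ‖WithLp.toLp r (fun i => ‖e i‖)‖ ≤ 1 := by
    rw [norm_toLp_le_iff hr _ zero_le_one]
    simpa using he
  calc ‖y‖ ≤ ‖lpSum s (fun i => S (e i))‖ :=
        norm_le_norm_of_abs_le_abs (hy.trans (le_abs_self _))
    _ ≤ K * ‖WithLp.toLp r (fun i => ‖e i‖)‖ := hK n e
    _ ≤ K * 1 := by gcongr
    _ = K := mul_one K

/-- The families witnessing the `y i`, scaled by `c i` and concatenated, witness the result. This is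
convexity with constant `1` at the level of generators. -/
theorem lpSum_smul_mem_convexGenerators {r s : ℝ≥0∞} {S : E →L[ℝ] Y}
    {n : ℕ} {c : Fin n → ℝ} (hc : ∀ i, 0 ≤ c i) (hc1 : ∑ i, c i ^ r.toReal ≤ 1) {y : Fin n → Y}
    (hy : ∀ i, y i ∈ convexGenerators r s S) :
    lpSum s (fun i => c i • y i) ∈ convexGenerators r s S := by
  choose k e he hye using hy
  have σ := finSigmaFinEquiv (n := k)
  refine ⟨∑ i, k i, fun l => c (σ.symm l).1 • e (σ.symm l).1 (σ.symm l).2, ?_, ?_⟩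
  · rw [σ.symm.sum_comp fun l => ‖c l.1 • e l.1 l.2‖ ^ r.toReal, Fintype.sum_sigma]
    refine le_trans (Finset.sum_le_sum fun i _ => ?_) hc1
    simp only [norm_smul, Real.norm_eq_abs, abs_of_nonneg (hc i)]
    rw [Finset.sum_congr rfl fun j _ => Real.mul_rpow (hc i) (norm_nonneg _), ← Finset.mul_sum]
    exact mul_le_of_le_one_right (Real.rpow_nonneg (hc i) _) (he i)
  · rw [abs_of_nonneg (lpSum_nonneg _ _)]
    simp only [map_smul]
    exact lpSum_smul_le_lpSum_concat s hc y (fun i j => S (e i j)) hye σ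

/-- By sublinearity of `lpSum` and solidity of the hull, the admissible tuples form a convex set; it
contains `Bⁿ`, whose convex hull is the product of the hulls. -/
theorem lpSum_smul_mem_convexHull {s : ℝ≥0∞} {B : Set Y} (hB : IsSolidSet B) {n : ℕ}
    {c : Fin n → ℝ} (h : ∀ y : Fin n → Y, (∀ i, y i ∈ B) → lpSum s (fun i => c i • y i) ∈ B)
    {y : Fin n → Y} (hy : ∀ i, y i ∈ convexHull ℝ B) :
    lpSum s (fun i => c i • y i) ∈ convexHull ℝ B := by
  have hconv : Convex ℝ {y : Fin n → Y | lpSum s (fun i => c i • y i) ∈ convexHull ℝ B} := by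
    intro y hy y' hy' a b ha hb hab
    refine hB.convexHull _ (convex_convexHull ℝ B hy hy' ha hb hab) _ ?_
    rw [abs_of_nonneg (lpSum_nonneg _ _)]
    refine le_trans ?_ (le_abs_self _)
    rw [← lpSum_smul s ha, ← lpSum_smul s hb]
    refine le_trans (le_of_eq ?_) (lpSum_add_le s _ _)
    congr 1
    ext i
    simp only [Pi.add_apply, Pi.smul_apply, smul_add, smul_comm (c i)]
  have hsub : Set.univ.pi (fun _ : Fin n => B) ⊆
      {y : Fin n → Y | lpSum s (fun i => c i • y i) ∈ convexHull ℝ B} := fun y hy =>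
    subset_convexHull ℝ B (h y fun i => hy i trivial)
  have := convexHull_min hsub hconv
  rw [convexHull_pi] at this
  exact this fun i _ => hy i

theorem lpSum_smul_mem_closure {s : ℝ≥0∞} {B : Set Y} {n : ℕ} {c : Fin n → ℝ}
    (h : ∀ y : Fin n → Y, (∀ i, y i ∈ B) → lpSum s (fun i => c i • y i) ∈ B)
    {y : Fin n → Y} (hy : ∀ i, y i ∈ closure B) :
    lpSum s (fun i => c i • y i) ∈ closure B := by
  have hcont : Continuous fun y : Fin n → Y => lpSum s (fun i => c i • y i) :=
    (continuous_lpSum s n).comp (by fun_prop)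
  refine map_mem_closure (f := fun y : Fin n → Y => lpSum s (fun i => c i • y i)) hcont
    (s := Set.univ.pi fun _ => B) ?_ fun y hy => h y fun i => hy i trivial
  rw [closure_pi_set]
  exact fun i _ => hy i

/-- For `r < ∞`, convexity of an operator may be tested on the open unit ball. -/
theorem isConvexOperator_of_norm_lpSum_le {r s : ℝ≥0∞} (hr : 0 < r.toReal) {S : E →L[ℝ] Y}
    {K : ℝ} (hK : 1 ≤ K)
    (h : ∀ (n : ℕ) (c : Fin n → ℝ) (e : Fin n → E), (∀ i, 0 ≤ c i) → ∑ i, c i ^ r.toReal ≤ 1 →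
      (∀ i, ‖e i‖ < 1) → ‖lpSum s (fun i => c i • S (e i))‖ ≤ K) : IsConvexOperator r s S := by
  refine ⟨K, hK, fun n e => ?_⟩
  -- Adding `δ` to each norm allows every vector, even zero, to be normalized into the open ball;
  -- the outer `δ` keeps the total `M` positive even for an empty family. Both vanish as `δ → 0`.
  have hδ : ∀ δ : ℝ, 0 < δ → ‖lpSum s (fun i => S (e i))‖ ≤
      K * (‖WithLp.toLp r (fun i => ‖e i‖ + δ)‖ + δ) := by
    intro δ hδ
    have ht : ∀ i, 0 < ‖e i‖ + δ := fun i => by positivity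
    have hn0 : 0 ≤ ‖WithLp.toLp r (fun i => ‖e i‖ + δ)‖ := by
      rw [PiLp.norm_eq_sum hr]
      positivity
    set M := ‖WithLp.toLp r (fun i => ‖e i‖ + δ)‖ + δ with hM
    have hMpos : 0 < M := by positivity
    have h1 := (norm_toLp_le_iff hr (fun i => ‖e i‖ + δ) hMpos.le).1 (by linarith)
    have h2 := h n (fun i => (‖e i‖ + δ) / M) (fun i => (‖e i‖ + δ)⁻¹ • e i)
      (fun i => (div_pos (ht i) hMpos).le) (by
        simp only [Real.div_rpow (ht _).le hMpos.le]
        rw [← Finset.sum_div, div_le_one (Real.rpow_pos_of_pos hMpos _)]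
        simpa only [abs_of_pos (ht _)] using h1) (fun i => by
        rw [norm_smul, norm_inv, Real.norm_of_nonneg (ht i).le, inv_mul_lt_iff₀ (ht i)]
        linarith)
    have h3 : (fun i => ((‖e i‖ + δ) / M) • S ((‖e i‖ + δ)⁻¹ • e i)) =
        M⁻¹ • fun i => S (e i) := by
      ext i
      rw [Pi.smul_apply, map_smul, smul_smul]
      congr 1
      have := (ht i).ne'
      field_simp
    rw [h3, lpSum_smul s (inv_nonneg.2 hMpos.le), norm_smul, norm_inv,
      Real.norm_of_nonneg hMpos.le, inv_mul_le_iff₀ hMpos] at h2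
    linarith
  have hcont : Continuous fun δ : ℝ => K * (‖WithLp.toLp r (fun i => ‖e i‖ + δ)‖ + δ) := by
    simp only [PiLp.norm_eq_sum hr, Real.norm_eq_abs]
    refine continuous_const.mul (Continuous.add ?_ continuous_id)
    refine Continuous.rpow_const (continuous_finsetSum _ fun i _ => ?_)
      fun _ => Or.inr (by positivity)
    exact Continuous.rpow_const (by fun_prop) fun _ => Or.inr hr.le
  have hlim := (hcont.tendsto 0).mono_left (nhdsWithin_le_nhds (s := Set.Ioi 0))
  simp only [add_zero] at hlim
  exact ge_of_tendsto hlim (by filter_upwards [self_mem_nhdsWithin] with δ h using hδ δ h)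

/-- Take for `Z` the ideal whose unit ball is the closed convex hull of the generators. Convexity of
`S` makes this ball bounded, and its stability under weighted `lpSum`s makes `Z` convex with
constant `1`. -/
theorem exists_factorization_convexLattice {r s : ℝ≥0∞} (hr : 0 < r.toReal) {S : E →L[ℝ] Y}
    (hS : IsConvexOperator r s S) :
    ∃ (Z : Type v) (_ : NormedAddCommGroup Z) (_ : NormedSpace ℝ Z) (_ : Lattice Z)
      (_ : IsBanachLattice Z) (Φ : Z →L[ℝ] Y) (R : E →L[ℝ] Z), IsConvexLattice r s Z ∧
      IsLatticeHom Φ ∧ Function.Injective Φ ∧ IsIntervalPreserving Φ ∧ S = Φ ∘L R := by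
  have hBs := isSolidSet_convexGenerators r s S
  set B := convexGenerators r s S with hB
  have hSB : ∀ e, ‖e‖ ≤ 1 → S e ∈ closure (convexHull ℝ B) := fun e he =>
    subset_closure (subset_convexHull ℝ B (map_mem_convexGenerators s S he))
  obtain ⟨K, hK⟩ := exists_bound_convexGenerators hr hS
  have hK' : ∀ y ∈ closure (convexHull ℝ B), ‖y‖ ≤ K := by
    have h1 : convexHull ℝ B ⊆ Metric.closedBall 0 K :=
      convexHull_min (fun y hy => by simpa using hK y hy) (convex_closedBall 0 K)
    intro y hy
    simpa using closure_minimal h1 Metric.isClosed_closedBall hy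
  obtain ⟨Z, i₁, i₂, i₃, i₄, Φ, hlat, hinj, hideal, hball, hrange⟩ :=
    exists_banachLattice_ideal (convex_convexHull ℝ B).closure hBs.convexHull.closure
      ⟨_, hSB 0 (by simp)⟩ isClosed_closure hK'
  have hR : ∀ e, ∃ z, Φ z = S e := by
    intro e
    have hpos : 0 < ‖e‖ + 1 := by positivity
    obtain ⟨z, hz⟩ := hrange _ (hSB ((‖e‖ + 1)⁻¹ • e) (by
      rw [norm_smul, norm_inv, Real.norm_of_nonneg hpos.le, inv_mul_le_iff₀ hpos]
      linarith))
    exact ⟨(‖e‖ + 1) • z, by rw [map_smul, hz, map_smul, smul_inv_smul₀ hpos.ne']⟩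
  choose R hR using hR
  let R' : E →ₗ[ℝ] Z :=
    { toFun := R
      map_add' := fun e f => hinj (by rw [map_add, hR, hR, hR, map_add])
      map_smul' := fun c e => hinj (by rw [map_smul, hR, hR, map_smul, RingHom.id_apply]) }
  have hRn : ∀ e, ‖R' e‖ ≤ 1 * ‖e‖ := by
    intro e
    refine le_of_forall_pos_le_add fun ε hε => ?_
    have hpos : 0 < 1 * ‖e‖ + ε := by positivity
    rw [hball _ _ hpos]
    change _ • Φ (R e) ∈ _
    rw [hR, ← map_smul]
    refine hSB _ ?_
    rw [norm_smul, norm_inv, Real.norm_of_nonneg hpos.le, inv_mul_le_iff₀ hpos]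
    linarith
  refine ⟨Z, i₁, i₂, i₃, i₄, Φ, R'.mkContinuous 1 hRn, ?_, hlat, hinj,
    hlat.isIntervalPreserving hinj hideal, ?_⟩
  · refine isConvexOperator_of_norm_lpSum_le hr le_rfl fun n c z hc hc1 hz => ?_
    simp only [ContinuousLinearMap.id_apply]
    rw [hball _ _ one_pos, inv_one, one_smul, hlat.map_lpSum hinj hideal]
    simp only [map_smul]
    refine lpSum_smul_mem_closure (fun y hy => lpSum_smul_mem_convexHull hBs
      (fun y hy => lpSum_smul_mem_convexGenerators hc hc1 hy) hy) fun i => ?_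
    have := (hball _ _ one_pos).1 (hz i).le
    rwa [inv_one, one_smul] at this
  · ext e
    exact (hR e).symm

end Factorization

/-! ### Finite-dimensional `ℓ^q` norms. -/

section PiLpNorm

theorem norm_toLp_nonneg {q : ℝ≥0∞} (hq : 1 ≤ q) {n : ℕ} (a : Fin n → ℝ) :
    0 ≤ ‖WithLp.toLp q a‖ := by
  have : Fact (1 ≤ q) := ⟨hq⟩
  exact norm_nonneg _

theorem toReal_pos_of_one_le {q : ℝ≥0∞} (hq : 1 ≤ q) (hT : q ≠ ⊤) : 0 < q.toReal :=
  ENNReal.toReal_pos (zero_lt_one.trans_le hq).ne' hT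

theorem norm_toLp_top_le_iff {n : ℕ} (a : Fin n → ℝ) {t : ℝ} (ht : 0 ≤ t) :
    ‖WithLp.toLp ⊤ a‖ ≤ t ↔ ∀ i, |a i| ≤ t := by
  rw [PiLp.norm_toLp, pi_norm_le_iff_of_nonneg ht]
  rfl

theorem norm_toLp_mono {q : ℝ≥0∞} (hq : 1 ≤ q) {n : ℕ} {a b : Fin n → ℝ} (ha : ∀ i, 0 ≤ a i)
    (h : ∀ i, a i ≤ b i) : ‖WithLp.toLp q a‖ ≤ ‖WithLp.toLp q b‖ := by
  have h0 := norm_toLp_nonneg hq b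
  have habs : ∀ i, |a i| ≤ |b i| := fun i => abs_le_abs_of_nonneg (ha i) (h i)
  rcases eq_or_ne q ⊤ with rfl | hT
  · rw [norm_toLp_top_le_iff a h0]
    exact fun i => (habs i).trans ((norm_toLp_top_le_iff b h0).1 le_rfl i)
  · have hr := toReal_pos_of_one_le hq hT
    rw [norm_toLp_le_iff hr a h0]
    exact (Finset.sum_le_sum fun i _ => Real.rpow_le_rpow (abs_nonneg _) (habs i) hr.le).trans
      ((norm_toLp_le_iff hr b h0).1 le_rfl)

end PiLpNorm

/-! ### The functional extracted from concavity. -/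

section LowerNorm

variable {X : Type u} {Y : Type v} [NormedAddCommGroup X] [NormedSpace ℝ X] [Lattice X]
  [IsBanachLattice X] [NormedAddCommGroup Y] [NormedSpace ℝ Y]

/-- A positively homogeneous solid functional `ρ` on `X` with a lower `q`-estimate which dominates
`‖T ·‖` and is dominated by `K ‖·‖`. -/
structure IsLowerNorm (q : ℝ≥0∞) (T : X →L[ℝ] Y) (K : ℝ) (ρ : X → ℝ) : Prop where
  nonneg : ∀ x, 0 ≤ ρ x
  mono : ∀ x y, |x| ≤ |y| → ρ x ≤ ρ y
  smul_le : ∀ (c : ℝ) (x : X), 0 < c → ρ (c • x) ≤ c * ρ x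
  norm_map_le : ∀ x, ‖T x‖ ≤ ρ x
  le_norm : ∀ x, ρ x ≤ K * ‖x‖
  lower : ∀ (n : ℕ) (x : Fin n → X) (y : X), ∑ i, |x i| ≤ |y| →
    ‖WithLp.toLp q (fun i => ρ (x i))‖ ≤ ρ y

/-- At `q = ∞` the lower estimate is mere monotonicity, so a multiple of the norm suffices. -/
theorem isLowerNorm_top (T : X →L[ℝ] Y) : IsLowerNorm ⊤ T ‖T‖ (fun x => ‖T‖ * ‖x‖) where
  nonneg x := by positivity
  mono x y h := by
    gcongr
    exact norm_le_norm_of_abs_le_abs h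
  smul_le c x hc := by
    rw [norm_smul, Real.norm_of_nonneg hc.le]
    exact (mul_left_comm _ _ _).le
  norm_map_le x := T.le_opNorm x
  le_norm x := le_rfl
  lower n x y h := by
    rw [norm_toLp_top_le_iff _ (by positivity)]
    intro i
    rw [abs_of_nonneg (by positivity)]
    gcongr
    exact norm_le_norm_of_abs_le_abs
      ((Finset.single_le_sum (fun j _ => abs_nonneg (x j)) (Finset.mem_univ i)).trans h)

/-- For finite `q`, `ρ(y)^q` is the supremum of `∑ ‖T xᵢ‖^q` over `∑ |xᵢ| ≤ |y|`. Concavity bounds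
it by `(K ‖y‖)^q`, and one-term families show that it dominates `‖T y‖^q`. -/
theorem exists_isLowerNorm {q : ℝ≥0∞} (hq : 1 ≤ q) {T : X →L[ℝ] Y}
    (hT : IsConcaveOperator q 1 T) : ∃ (K : ℝ) (ρ : X → ℝ), IsLowerNorm q T K ρ := by
  rcases eq_or_ne q ⊤ with rfl | hqT
  · exact ⟨_, _, isLowerNorm_top T⟩
  obtain ⟨K, hK1, hK⟩ := hT
  have hr := toReal_pos_of_one_le hq hqT
  set r := q.toReal with hrdef
  let S : X → Set ℝ := fun y =>
    {t | ∃ (n : ℕ) (x : Fin n → X), ∑ i, |x i| ≤ |y| ∧ ∑ i, ‖T (x i)‖ ^ r = t}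
  have hbdd : ∀ y, ∀ t ∈ S y, t ≤ (K * ‖y‖) ^ r := by
    rintro y _ ⟨n, x, hx, rfl⟩
    have h0 : 0 ≤ ∑ i, |x i| := Finset.sum_nonneg fun i _ => abs_nonneg _
    have h1 : ‖WithLp.toLp q (fun i => ‖T (x i)‖)‖ ≤ K * ‖y‖ := by
      refine (hK n x).trans ?_
      rw [lpSum_one]
      gcongr
      exact norm_le_norm_of_abs_le_abs (by rwa [abs_of_nonneg h0])
    simpa using (norm_toLp_le_iff hr _ (by positivity)).1 h1
  have hne : ∀ y, (0 : ℝ) ∈ S y := fun y => ⟨0, Fin.elim0, by simp, by simp⟩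
  have hlub : ∀ y, IsLUB (S y) (sSup (S y)) := fun y =>
    isLUB_csSup ⟨0, hne y⟩ ⟨_, hbdd y⟩
  have hσ0 : ∀ y, 0 ≤ sSup (S y) := fun y => (hlub y).1 (hne y)
  have hle : ∀ y s, 0 ≤ s → ((sSup (S y)) ^ r⁻¹ ≤ s ↔ sSup (S y) ≤ s ^ r) := by
    intro y s hs
    rw [← Real.rpow_le_rpow_iff (Real.rpow_nonneg (hσ0 y) _) hs hr, ← Real.rpow_mul (hσ0 y),
      inv_mul_cancel₀ hr.ne', Real.rpow_one]
  have hpow : ∀ y, ((sSup (S y)) ^ r⁻¹) ^ r = sSup (S y) := fun y => by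
    rw [← Real.rpow_mul (hσ0 y), inv_mul_cancel₀ hr.ne', Real.rpow_one]
  refine ⟨K, fun y => (sSup (S y)) ^ r⁻¹, fun y => Real.rpow_nonneg (hσ0 y) _, fun x y hxy => ?_,
    fun c y hc => ?_, fun y => ?_, fun y => ?_, fun n x y hxy => ?_⟩
  · refine Real.rpow_le_rpow (hσ0 x) ((hlub x).2 ?_) (inv_nonneg.2 hr.le)
    rintro _ ⟨n, z, hz, rfl⟩
    exact (hlub y).1 ⟨n, z, hz.trans hxy, rfl⟩
  · rw [hle _ _ (mul_nonneg hc.le (Real.rpow_nonneg (hσ0 y) _)),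
      Real.mul_rpow hc.le (Real.rpow_nonneg (hσ0 y) _), hpow]
    refine (hlub _).2 ?_
    rintro _ ⟨n, z, hz, rfl⟩
    have h1 : ∑ i, ‖T (c⁻¹ • z i)‖ ^ r ≤ sSup (S y) := by
      refine (hlub y).1 ⟨n, fun i => c⁻¹ • z i, ?_, rfl⟩
      simp only [abs_smul_eq, abs_of_pos (inv_pos.2 hc)]
      rw [← Finset.smul_sum]
      have := smul_le_smul_of_nonneg_left hz (inv_nonneg.2 hc.le)
      rwa [abs_smul_eq, abs_of_pos hc, inv_smul_smul₀ hc.ne'] at this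
    calc ∑ i, ‖T (z i)‖ ^ r = c ^ r * ∑ i, ‖T (c⁻¹ • z i)‖ ^ r := by
          rw [Finset.mul_sum]
          refine Finset.sum_congr rfl fun i _ => ?_
          rw [← Real.mul_rpow hc.le (norm_nonneg _), map_smul, norm_smul, norm_inv,
            Real.norm_of_nonneg hc.le, mul_inv_cancel_left₀ hc.ne']
      _ ≤ _ := by gcongr
  · rw [← Real.rpow_le_rpow_iff (norm_nonneg _) (Real.rpow_nonneg (hσ0 y) _) hr, hpow]
    exact (hlub y).1 ⟨1, fun _ => y, by simp, by simp⟩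
  · rw [hle _ _ (by positivity)]
    exact (hlub y).2 (hbdd y)
  · rw [norm_toLp_le_iff hr _ (Real.rpow_nonneg (hσ0 y) _), hpow]
    simp only [abs_of_nonneg (Real.rpow_nonneg (hσ0 _) _), ← hrdef, hpow]
    -- Families admissible for the separate `x i` concatenate to one admissible for `y`, so the
    -- suprema are superadditive.
    refine sum_le_of_isLUB (fun i => S (x i)) _ (fun i => hlub _) fun t ht => ?_
    choose k z hz hzt using ht
    have σ := finSigmaFinEquiv (n := k)
    refine (hlub y).1 ⟨∑ i, k i, fun l => z (σ.symm l).1 (σ.symm l).2, ?_, ?_⟩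
    · rw [σ.symm.sum_comp fun l => |z l.1 l.2|, Fintype.sum_sigma]
      exact (Finset.sum_le_sum fun i _ => hz i).trans hxy
    · rw [σ.symm.sum_comp fun l => ‖T (z l.1 l.2)‖ ^ r, Fintype.sum_sigma]
      exact Finset.sum_congr rfl fun i _ => hzt i

end LowerNorm

/-! ### The interpolated seminorm and its lower estimate. -/

section Atoms

variable {X : Type u} {Y : Type v} [NormedAddCommGroup X] [NormedSpace ℝ X] [Lattice X]
  [IsBanachLattice X] [NormedAddCommGroup Y] [NormedSpace ℝ Y]

theorem gauge_le_gauge_of_isSolidSet {D : Set X} (hD : IsSolidSet D) (habs : Absorbent ℝ D)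
    {x y : X} (h : |x| ≤ |y|) : gauge D x ≤ gauge D y := by
  refine le_of_forall_gt_imp_ge_of_dense fun t ht => ?_
  obtain ⟨b, hb, hbt, hy⟩ := exists_lt_of_gauge_lt habs ht
  refine (gauge_le_of_mem hb.le ?_).trans hbt.le
  rw [Set.mem_smul_set_iff_inv_smul_mem₀ hb.ne'] at hy ⊢
  exact hD.smul hy h

/-- The elements `u` with `‖u‖ ≤ a` and `ρ u ≤ b` for some `a, b > 0` such that
`a ^ θ * b ^ (1 - θ) = 1`. -/
def interpolationAtoms (θ : ℝ) (ρ : X → ℝ) : Set X :=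
  {x | ∃ a b : ℝ, 0 < a ∧ 0 < b ∧ ‖x‖ ≤ a ∧ ρ x ≤ b ∧ a ^ θ * b ^ (1 - θ) = 1}

variable {q : ℝ≥0∞} {T : X →L[ℝ] Y} {K : ℝ} {ρ : X → ℝ} {θ : ℝ}

theorem IsLowerNorm.isSolidSet (h : IsLowerNorm q T K ρ) :
    IsSolidSet (interpolationAtoms θ ρ) := by
  rintro x ⟨a, b, ha, hb, hxa, hxb, hab⟩ y hy
  exact ⟨a, b, ha, hb, (norm_le_norm_of_abs_le_abs hy).trans hxa, (h.mono _ _ hy).trans hxb, hab⟩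

theorem IsLowerNorm.closedBall_subset (h : IsLowerNorm q T K ρ) :
    Metric.closedBall 0 (|K| + 1)⁻¹ ⊆ convexHull ℝ (interpolationAtoms θ ρ) := by
  intro x hx
  have hx' : (|K| + 1) * ‖x‖ ≤ 1 := by
    rw [mem_closedBall_zero_iff] at hx
    calc (|K| + 1) * ‖x‖ ≤ (|K| + 1) * (|K| + 1)⁻¹ := by gcongr
      _ = 1 := mul_inv_cancel₀ (by positivity)
  have h1 : 0 ≤ |K| * ‖x‖ := by positivity
  -- The radius `(|K| + 1)⁻¹` makes both `‖x‖` and `ρ x` at most `1`, so `a = b = 1` works.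
  refine subset_convexHull ℝ _ ⟨1, 1, one_pos, one_pos, by linarith [norm_nonneg x], ?_, by simp⟩
  calc ρ x ≤ K * ‖x‖ := h.le_norm x
    _ ≤ |K| * ‖x‖ := by gcongr; exact le_abs_self K
    _ ≤ 1 := by linarith [norm_nonneg x]

theorem IsLowerNorm.absorbent (h : IsLowerNorm q T K ρ) :
    Absorbent ℝ (convexHull ℝ (interpolationAtoms θ ρ)) :=
  absorbent_nhds_zero (Filter.mem_of_superset
    (Metric.closedBall_mem_nhds 0 (by positivity : 0 < (|K| + 1)⁻¹)) h.closedBall_subset)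

/-- The seminorm whose unit ball is the convex hull of the atoms. -/
noncomputable def IsLowerNorm.seminorm (h : IsLowerNorm q T K ρ) (θ : ℝ) : Seminorm ℝ X :=
  gaugeSeminorm (𝕜 := ℝ) (h.isSolidSet (θ := θ)).convexHull.balanced (convex_convexHull ℝ _)
    h.absorbent

theorem IsLowerNorm.seminorm_mono (h : IsLowerNorm q T K ρ) {x y : X} (hxy : |x| ≤ |y|) :
    h.seminorm θ x ≤ h.seminorm θ y :=
  gauge_le_gauge_of_isSolidSet h.isSolidSet.convexHull h.absorbent hxy

theorem IsLowerNorm.seminorm_le_norm (h : IsLowerNorm q T K ρ) (x : X) :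
    h.seminorm θ x ≤ (|K| + 1) * ‖x‖ := by
  have h1 := mul_gauge_le_norm (x := x)
    (Metric.ball_subset_closedBall.trans (h.closedBall_subset (θ := θ)))
  rwa [inv_mul_le_iff₀ (by positivity)] at h1

theorem IsLowerNorm.mem_of_seminorm_lt_one (h : IsLowerNorm q T K ρ) {x : X}
    (hx : h.seminorm θ x < 1) : x ∈ convexHull ℝ (interpolationAtoms θ ρ) := by
  have h0 : (0 : X) ∈ interpolationAtoms θ ρ :=
    ⟨1, 1, one_pos, one_pos, by simp, (h.le_norm 0).trans (by simp), by simp⟩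
  exact setOfPred_gauge_lt_one_subset_self (convex_convexHull ℝ _) (subset_convexHull ℝ _ h0)
    h.absorbent hx

/-- Dividing `x` by `a^θ b^{1-θ}` turns it into an atom whenever `ρ x ≤ b`. Since `ρ x` may vanish,
`b = ρ x + ε` is used and `ε → 0`. -/
theorem IsLowerNorm.seminorm_le (h : IsLowerNorm q T K ρ) {x : X} {a : ℝ} (ha : 0 < a)
    (hxa : ‖x‖ ≤ a) (hθ1 : θ < 1) : h.seminorm θ x ≤ a ^ θ * ρ x ^ (1 - θ) := by
  have key : ∀ b, 0 < b → ρ x ≤ b → h.seminorm θ x ≤ a ^ θ * b ^ (1 - θ) := by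
    intro b hb hxb
    set c := a ^ θ * b ^ (1 - θ) with hc
    have hc0 : 0 < c := by positivity
    refine gauge_le_of_mem hc0.le ?_
    rw [Set.mem_smul_set_iff_inv_smul_mem₀ hc0.ne']
    refine subset_convexHull ℝ _ ⟨c⁻¹ * a, c⁻¹ * b, by positivity, by positivity, ?_, ?_, ?_⟩
    · rw [norm_smul, norm_inv, Real.norm_of_nonneg hc0.le]
      gcongr
    · exact (h.smul_le _ _ (inv_pos.2 hc0)).trans (by gcongr)
    · have hci : 0 < c⁻¹ := inv_pos.2 hc0
      rw [Real.mul_rpow hci.le ha.le, Real.mul_rpow hci.le hb.le, mul_mul_mul_comm,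
        ← Real.rpow_add hci, add_sub_cancel, Real.rpow_one, ← hc, inv_mul_cancel₀ hc0.ne']
  have hcont : Continuous fun ε : ℝ => a ^ θ * (ρ x + ε) ^ (1 - θ) :=
    continuous_const.mul (Continuous.rpow_const (by fun_prop) fun _ => Or.inr (by linarith))
  have hlim := (hcont.tendsto 0).mono_left (nhdsWithin_le_nhds (s := Set.Ioi 0))
  simp only [add_zero] at hlim
  refine ge_of_tendsto hlim ?_
  filter_upwards [self_mem_nhdsWithin] with ε hε
  have hε : 0 < ε := hε
  exact key _ (add_pos_of_nonneg_of_pos (h.nonneg x) hε) (by linarith)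

/-- All pieces share the bound `a`, so each has seminorm at most `a^θ ρ(x i)^{1-θ}`. The power
`q/(1-θ)` turns the second factor into `ρ(x i)^q`, whose sum is at most `b^q`. -/
theorem IsLowerNorm.norm_toLp_seminorm_le_one_of_mem_atoms (h : IsLowerNorm q T K ρ)
    (hq : 1 ≤ q) (hθ1 : θ < 1) {d : X} (hd : d ∈ interpolationAtoms θ ρ) {n : ℕ}
    {x : Fin n → X} (hx : ∑ i, |x i| ≤ |d|) :
    ‖WithLp.toLp (q / ENNReal.ofReal (1 - θ)) (fun i => h.seminorm θ (x i))‖ ≤ 1 := by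
  obtain ⟨a, b, ha, hb, hda, hdb, hab⟩ := hd
  have h1θ : 0 < 1 - θ := by linarith
  have hxd : ∀ i, |x i| ≤ |d| := fun i =>
    (Finset.single_le_sum (fun j _ => abs_nonneg (x j)) (Finset.mem_univ i)).trans hx
  have hN : ∀ i, h.seminorm θ (x i) ≤ a ^ θ * ρ (x i) ^ (1 - θ) := fun i =>
    h.seminorm_le ha ((norm_le_norm_of_abs_le_abs (hxd i)).trans hda) hθ1
  rcases eq_or_ne q ⊤ with rfl | hT
  · rw [ENNReal.top_div_of_ne_top ENNReal.ofReal_ne_top, norm_toLp_top_le_iff _ zero_le_one]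
    intro i
    rw [abs_of_nonneg (apply_nonneg _ _), ← hab]
    refine (hN i).trans ?_
    gcongr
    · exact h.nonneg _
    · exact (h.mono _ _ (hxd i)).trans hdb
  · have hr := toReal_pos_of_one_le hq hT
    have hlow := (norm_toLp_le_iff hr _ hb.le).1 ((h.lower n x d hx).trans hdb)
    simp only [abs_of_nonneg (h.nonneg _)] at hlow
    have hreal : (q / ENNReal.ofReal (1 - θ)).toReal = q.toReal / (1 - θ) := by
      rw [ENNReal.toReal_div, ENNReal.toReal_ofReal h1θ.le]
    have hr' : 0 < (q / ENNReal.ofReal (1 - θ)).toReal := by rw [hreal]; positivity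
    rw [norm_toLp_le_iff hr' _ zero_le_one, hreal, Real.one_rpow]
    have hpow : ∀ t : ℝ, 0 ≤ t → (a ^ θ * t ^ (1 - θ)) ^ (q.toReal / (1 - θ)) =
        (a ^ θ) ^ (q.toReal / (1 - θ)) * t ^ q.toReal := by
      intro t ht
      rw [Real.mul_rpow (by positivity) (by positivity), ← Real.rpow_mul ht,
        mul_div_cancel₀ _ h1θ.ne']
    calc ∑ i, |h.seminorm θ (x i)| ^ (q.toReal / (1 - θ))
        ≤ ∑ i, (a ^ θ * ρ (x i) ^ (1 - θ)) ^ (q.toReal / (1 - θ)) := by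
          refine Finset.sum_le_sum fun i _ => ?_
          rw [abs_of_nonneg (apply_nonneg _ _)]
          exact Real.rpow_le_rpow (apply_nonneg _ _) (hN i) (by positivity)
      _ = (a ^ θ) ^ (q.toReal / (1 - θ)) * ∑ i, ρ (x i) ^ q.toReal := by
          rw [Finset.mul_sum]
          exact Finset.sum_congr rfl fun i _ => hpow _ (h.nonneg _)
      _ ≤ (a ^ θ) ^ (q.toReal / (1 - θ)) * b ^ q.toReal := by gcongr
      _ = 1 := by rw [← hpow b hb.le, hab, Real.one_rpow]

theorem one_le_div_ofReal (hq : 1 ≤ q) (hθ0 : 0 < θ) : 1 ≤ q / ENNReal.ofReal (1 - θ) := by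
  have h1 : ENNReal.ofReal (1 - θ) ≤ 1 := by
    rw [← ENNReal.ofReal_one]
    exact ENNReal.ofReal_le_ofReal (by linarith)
  exact hq.trans (by simpa using ENNReal.div_le_div_left h1 q)

/-- The lower estimate for the interpolated seminorm. -/
theorem IsLowerNorm.norm_toLp_seminorm_le (h : IsLowerNorm q T K ρ)
    (hq : 1 ≤ q) (hθ0 : 0 < θ) (hθ1 : θ < 1) {n : ℕ} (x : Fin n → X) :
    ‖WithLp.toLp (q / ENNReal.ofReal (1 - θ)) (fun i => h.seminorm θ (x i))‖ ≤
      h.seminorm θ (∑ i, |x i|) := by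
  have hq' := one_le_div_ofReal hq hθ0
  have : Fact (1 ≤ q / ENNReal.ofReal (1 - θ)) := ⟨hq'⟩
  have hscale : ∀ {a : ℝ}, 0 < a → ∀ {y : X} {z : Fin n → X}, ∑ i, |z i| ≤ a • |y| →
      ∑ i, |a⁻¹ • z i| ≤ |y| := by
    intro a ha y z hz
    simp only [abs_smul_eq, abs_of_pos (inv_pos.2 ha)]
    rw [← Finset.smul_sum]
    have := smul_le_smul_of_nonneg_left hz (inv_nonneg.2 ha.le)
    rwa [inv_smul_smul₀ ha.ne'] at this
  have hnorm : ∀ {a : ℝ}, 0 < a → ∀ z : Fin n → X,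
      WithLp.toLp (q / ENNReal.ofReal (1 - θ)) (fun i => h.seminorm θ (z i)) =
      a • WithLp.toLp (q / ENNReal.ofReal (1 - θ)) (fun i => h.seminorm θ (a⁻¹ • z i)) := by
    intro a ha z
    rw [← WithLp.toLp_smul]
    congr 1
    ext i
    rw [Pi.smul_apply, map_smul_eq_mul, norm_inv, Real.norm_of_nonneg ha.le, smul_eq_mul,
      mul_inv_cancel_left₀ ha.ne']
  -- Quantifying over all families below `d` is what makes the condition convex: a family below a
  -- convex combination splits by Riesz decomposition, and Minkowski's inequality recombines the
  -- parts.
  have hconv : Convex ℝ {d : X | ∀ x : Fin n → X, ∑ i, |x i| ≤ |d| →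
      ‖WithLp.toLp (q / ENNReal.ofReal (1 - θ)) (fun i => h.seminorm θ (x i))‖ ≤ 1} := by
    rw [convex_iff_forall_pos]
    intro d hd d' hd' a b ha hb hab x hx
    have hx' : ∑ i, |x i| ≤ a • |d| + b • |d'| := by
      refine hx.trans ((abs_add_le _ _).trans (le_of_eq ?_))
      rw [abs_smul_eq, abs_smul_eq, abs_of_pos ha, abs_of_pos hb]
    obtain ⟨x₁, x₂, rfl, h₁, h₂⟩ := exists_sum_abs_le_add_eq Finset.univ x
      (smul_nonneg ha.le (abs_nonneg d)) (smul_nonneg hb.le (abs_nonneg d')) hx'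
    calc _ ≤ ‖WithLp.toLp (q / ENNReal.ofReal (1 - θ))
          (fun i => h.seminorm θ (x₁ i) + h.seminorm θ (x₂ i))‖ :=
          norm_toLp_mono hq' (fun i => apply_nonneg _ _) fun i => map_add_le_add _ _ _
      _ ≤ ‖WithLp.toLp (q / ENNReal.ofReal (1 - θ)) (fun i => h.seminorm θ (x₁ i))‖ +
          ‖WithLp.toLp (q / ENNReal.ofReal (1 - θ)) (fun i => h.seminorm θ (x₂ i))‖ :=
          norm_add_le (WithLp.toLp (q / ENNReal.ofReal (1 - θ)) (fun i => h.seminorm θ (x₁ i)))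
            (WithLp.toLp (q / ENNReal.ofReal (1 - θ)) (fun i => h.seminorm θ (x₂ i)))
      _ ≤ a * 1 + b * 1 := by
          rw [hnorm ha x₁, hnorm hb x₂, norm_smul, norm_smul, Real.norm_of_nonneg ha.le,
            Real.norm_of_nonneg hb.le]
          gcongr
          · exact hd _ (hscale ha h₁)
          · exact hd' _ (hscale hb h₂)
      _ = 1 := by linarith
  have hsub : interpolationAtoms θ ρ ⊆ {d : X | ∀ x : Fin n → X, ∑ i, |x i| ≤ |d| →
      ‖WithLp.toLp (q / ENNReal.ofReal (1 - θ)) (fun i => h.seminorm θ (x i))‖ ≤ 1} :=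
    fun d hd x hx => h.norm_toLp_seminorm_le_one_of_mem_atoms hq hθ1 hd hx
  have hhull := convexHull_min hsub hconv
  refine le_of_forall_gt_imp_ge_of_dense fun t ht => ?_
  obtain ⟨b, hb, hbt, hy⟩ := exists_lt_of_gauge_lt h.absorbent ht
  rw [Set.mem_smul_set_iff_inv_smul_mem₀ hb.ne'] at hy
  have h0 : 0 ≤ ∑ i, |x i| := Finset.sum_nonneg fun i _ => abs_nonneg _
  have := hhull hy (fun i => b⁻¹ • x i) (by
    rw [abs_smul_eq, abs_of_nonneg h0, abs_of_pos (inv_pos.2 hb), Finset.smul_sum]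
    simp only [abs_smul_eq, abs_of_pos (inv_pos.2 hb)]
    exact le_rfl)
  rw [hnorm hb x, norm_smul, Real.norm_of_nonneg hb.le]
  exact (mul_le_of_le_one_right hb.le this).trans hbt.le

end Atoms

/-! ### Arithmetic of the interpolated exponents. -/

section Exponents

/-- The conventions `toReal ⊤ = 0` and `0⁻¹ = 0` keep this real identity valid at infinite
exponents. -/
theorem inv_toReal_add_inv_conjExponent_toReal {q : ℝ≥0∞} (hq : 1 ≤ q) :
    (q.toReal)⁻¹ + (q.conjExponent.toReal)⁻¹ = 1 := by
  have h := (ENNReal.HolderConjugate.conjExponent hq).inv_add_inv_eq_one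
  have h0 : q ≠ 0 := (zero_lt_one.trans_le hq).ne'
  have h0' : q.conjExponent ≠ 0 := (zero_lt_one.trans_le (one_le_conjExponent q)).ne'
  rw [← ENNReal.toReal_inv, ← ENNReal.toReal_inv,
    ← ENNReal.toReal_add (ENNReal.inv_ne_top.2 h0) (ENNReal.inv_ne_top.2 h0'), h,
    ENNReal.toReal_one]

theorem inv_toReal_of_one_div_eq {p pθ : ℝ≥0∞} (hp : 1 ≤ p) {θ : ℝ} (hθ₀ : 0 < θ) (hθ₁ : θ < 1)
    (h : 1 / pθ = ENNReal.ofReal θ / p + ENNReal.ofReal (1 - θ)) :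
    (pθ.toReal)⁻¹ = θ * (p.toReal)⁻¹ + (1 - θ) := by
  have h1 := congrArg ENNReal.toReal h
  have h0 : p ≠ 0 := (zero_lt_one.trans_le hp).ne'
  rwa [ENNReal.toReal_add (ENNReal.div_ne_top ENNReal.ofReal_ne_top h0) ENNReal.ofReal_ne_top,
    ENNReal.toReal_div, ENNReal.toReal_div, ENNReal.toReal_one, ENNReal.toReal_ofReal hθ₀.le,
    ENNReal.toReal_ofReal (by linarith), one_div, div_eq_mul_inv] at h1

theorem one_le_of_one_div_eq {p pθ : ℝ≥0∞} (hp : 1 ≤ p) {θ : ℝ} (hθ₀ : 0 < θ) (hθ₁ : θ < 1)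
    (h : 1 / pθ = ENNReal.ofReal θ / p + ENNReal.ofReal (1 - θ)) : 1 ≤ pθ := by
  rw [← ENNReal.inv_le_one, ← one_div, h]
  calc ENNReal.ofReal θ / p + ENNReal.ofReal (1 - θ)
      ≤ ENNReal.ofReal θ / 1 + ENNReal.ofReal (1 - θ) := by gcongr
    _ = 1 := by
      rw [div_one, ← ENNReal.ofReal_add hθ₀.le (by linarith), add_sub_cancel, ENNReal.ofReal_one]

/-- Coordinates are at most `1` in modulus and `θ⁻¹ ≥ 1`, so the power only shrinks them. This
serves the case where the inner exponent stays `∞`. -/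
theorem rpow_mem_dualBall_self {s : ℝ≥0∞} {θ : ℝ} (hθ₀ : 0 < θ) (hθ₁ : θ < 1) {n : ℕ}
    {a : Fin n → ℝ} (ha : a ∈ dualBall s n) : (fun i => |a i| ^ θ⁻¹) ∈ dualBall s n := by
  refine mem_dualBall_of_abs_le ha fun i => ?_
  rw [abs_of_nonneg (by positivity)]
  have := Real.rpow_le_rpow_of_exponent_ge' (abs_nonneg (a i)) (abs_le_one_of_mem_dualBall ha i)
    zero_le_one (one_le_inv₀ hθ₀ |>.2 hθ₁.le)
  rwa [Real.rpow_one] at this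

/-- The conjugate exponents satisfy `1/pθ* = θ/p*`, because the other endpoint `1` has conjugate
`∞`. Hence `|a|^{p*/θ} = |a|^{pθ*}` when `p*` is finite. -/
theorem rpow_mem_dualBall {p pθ : ℝ≥0∞} (hp : 1 ≤ p) {θ : ℝ} (hθ₀ : 0 < θ) (hθ₁ : θ < 1)
    (h : 1 / pθ = ENNReal.ofReal θ / p + ENNReal.ofReal (1 - θ)) {n : ℕ}
    {a : Fin n → ℝ} (ha : a ∈ dualBall pθ n) : (fun i => |a i| ^ θ⁻¹) ∈ dualBall p n := by
  have h1 := inv_toReal_add_inv_conjExponent_toReal hp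
  have h2 := inv_toReal_add_inv_conjExponent_toReal (one_le_of_one_div_eq hp hθ₀ hθ₁ h)
  have h3 := inv_toReal_of_one_div_eq hp hθ₀ hθ₁ h
  have h4 : (pθ.conjExponent.toReal)⁻¹ = θ * (p.conjExponent.toReal)⁻¹ := by
    linear_combination h2 - h3 - θ * h1
  by_cases hT : p.conjExponent = ⊤
  · rw [mem_dualBall_iff_of_eq_top hT]
    intro i
    rw [abs_of_nonneg (by positivity)]
    exact Real.rpow_le_one (abs_nonneg _) (abs_le_one_of_mem_dualBall ha i)
      (inv_nonneg.2 hθ₀.le)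
  · have hpos := conjExponent_toReal_pos hT
    have hT' : pθ.conjExponent ≠ ⊤ := by
      intro hT'
      rw [hT', ENNReal.toReal_top, inv_zero] at h4
      have : 0 < θ * (p.conjExponent.toReal)⁻¹ := by positivity
      linarith
    rw [mem_dualBall_iff_of_ne_top hT'] at ha
    rw [mem_dualBall_iff_of_ne_top hT]
    have h5 : θ⁻¹ * p.conjExponent.toReal = pθ.conjExponent.toReal := by
      rw [← inv_inj, h4, mul_inv, inv_inv]
    refine le_trans (le_of_eq (Finset.sum_congr rfl fun i _ => ?_)) ha
    rw [abs_of_nonneg (by positivity), ← Real.rpow_mul (abs_nonneg _), h5]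

end Exponents

/-! ### Interpolated convexity and its passage to the completion. -/

section Interpolation

variable {X : Type u} {Y : Type v} [NormedAddCommGroup X] [NormedSpace ℝ X] [Lattice X]
  [IsBanachLattice X] [NormedAddCommGroup Y] [NormedSpace ℝ Y] [Lattice Y] [IsBanachLattice Y]

/-- A Hölder–Young inequality in Banach lattices. -/
theorem lpSum_geom_mean_le {s p₂ : ℝ≥0∞} {θ : ℝ} (hθ₀ : 0 < θ) (hθ₁ : θ < 1) {n : ℕ}
    (hball : ∀ a ∈ dualBall s n, (fun i => |a i| ^ θ⁻¹) ∈ dualBall p₂ n) {u v : Fin n → ℝ}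
    (hu : ∀ i, 0 ≤ u i) (hv : ∀ i, 0 ≤ v i) (y : Fin n → Y) :
    lpSum s (fun i => (u i ^ θ * v i ^ (1 - θ)) • y i) ≤
      θ • lpSum p₂ (fun i => u i • y i) + (1 - θ) • ∑ i, v i • |y i| := by
  refine lpSum_le fun a ha => ?_
  have h1 := sum_smul_abs_le_lpSum p₂ (fun i => u i • y i) (hball a ha)
  calc ∑ i, a i • (u i ^ θ * v i ^ (1 - θ)) • y i
      ≤ ∑ i, (θ * (|a i| ^ θ⁻¹ * u i) + (1 - θ) * v i) • |y i| := by
        refine Finset.sum_le_sum fun i _ => ?_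
        rw [smul_smul]
        refine (smul_le_abs_smul_abs _ _).trans (smul_le_smul_right_of_nonneg ?_ (abs_nonneg _))
        -- Weighted AM–GM with the dual coefficient placed wholly in the first factor, as `(|a
        -- i|^{1/θ})^θ = |a i|`; the second term is then a plain `ℓ¹` sum.
        have h2 := Real.geom_mean_le_arith_mean2_weighted hθ₀.le (sub_nonneg.2 hθ₁.le)
          (mul_nonneg (Real.rpow_nonneg (abs_nonneg (a i)) θ⁻¹) (hu i)) (hv i)
          (add_sub_cancel _ _)
        rw [Real.mul_rpow (Real.rpow_nonneg (abs_nonneg _) _) (hu i),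
          ← Real.rpow_mul (abs_nonneg _), inv_mul_cancel₀ hθ₀.ne', Real.rpow_one, mul_assoc] at h2
        rwa [abs_mul, abs_of_nonneg
          (mul_nonneg (Real.rpow_nonneg (hu i) θ) (Real.rpow_nonneg (hv i) (1 - θ)))]
    _ = θ • ∑ i, |(|a i| ^ θ⁻¹)| • |u i • y i| + (1 - θ) • ∑ i, v i • |y i| := by
        rw [Finset.smul_sum, Finset.smul_sum, ← Finset.sum_add_distrib]
        refine Finset.sum_congr rfl fun i _ => ?_
        rw [abs_of_nonneg (Real.rpow_nonneg (abs_nonneg (a i)) θ⁻¹), abs_smul_eq,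
          abs_of_nonneg (hu i), add_smul]
        simp only [smul_smul]
    _ ≤ _ := by gcongr

variable {q : ℝ≥0∞} {T : X →L[ℝ] Y} {K : ℝ} {ρ : X → ℝ} {θ : ℝ}

/-- The two bounds of an atom feed the two endpoints: `‖e i‖ ≤ a i` the convexity of `T`, and `‖T (e
i)‖ ≤ ρ (e i) ≤ b i` the triangle inequality. -/
theorem IsLowerNorm.norm_lpSum_le_of_mem_atoms (h : IsLowerNorm q T K ρ) {p p₂ s : ℝ≥0∞} {r C : ℝ}
    (hp : 1 ≤ p) (hr : r⁻¹ = θ * (p.toReal)⁻¹ + (1 - θ)) (hθ₀ : 0 < θ) (hθ₁ : θ < 1)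
    (hC : 1 ≤ C)
    (hT : ∀ (n : ℕ) (e : Fin n → X),
      ‖lpSum p₂ (fun i => T (e i))‖ ≤ C * ‖WithLp.toLp p (fun i => ‖e i‖)‖)
    {n : ℕ} (hball : ∀ a ∈ dualBall s n, (fun i => |a i| ^ θ⁻¹) ∈ dualBall p₂ n)
    {c : Fin n → ℝ} (hc : ∀ i, 0 ≤ c i) (hc1 : ∑ i, c i ^ r ≤ 1) {e : Fin n → X}
    (he : ∀ i, e i ∈ interpolationAtoms θ ρ) : ‖lpSum s (fun i => c i • T (e i))‖ ≤ C := by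
  choose a b ha hb hea heb hab using he
  have h1θ : 0 < 1 - θ := by linarith
  have hip : 0 ≤ (p.toReal)⁻¹ := inv_nonneg.2 ENNReal.toReal_nonneg
  have hr0 : r ≠ 0 := by
    rintro rfl
    rw [inv_zero] at hr
    nlinarith
  -- The `w i` have sum at most `1`. Dividing by `a i` and `b i` normalizes the atoms, and `u^θ
  -- v^{1-θ} = c` because `r (θ/p + 1 - θ) = 1` and `a^θ b^{1-θ} = 1`.
  set w : Fin n → ℝ := fun i => c i ^ r with hw
  have hw0 : ∀ i, 0 ≤ w i := fun i => Real.rpow_nonneg (hc i) r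
  set u : Fin n → ℝ := fun i => w i ^ (p.toReal)⁻¹ / a i with hu
  set v : Fin n → ℝ := fun i => w i / b i with hv
  have hu0 : ∀ i, 0 ≤ u i := fun i => div_nonneg (Real.rpow_nonneg (hw0 i) _) (ha i).le
  have hv0 : ∀ i, 0 ≤ v i := fun i => div_nonneg (hw0 i) (hb i).le
  have huv : ∀ i, u i ^ θ * v i ^ (1 - θ) = c i := by
    intro i
    rw [hu, hv]
    simp only
    rw [Real.div_rpow (Real.rpow_nonneg (hw0 i) _) (ha i).le, Real.div_rpow (hw0 i) (hb i).le,
      div_mul_div_comm, hab, div_one, ← Real.rpow_mul (hw0 i),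
      ← Real.rpow_add_of_nonneg (hw0 i) (by positivity) h1θ.le, mul_comm _ θ, ← hr,
      ← Real.rpow_mul (hc i), mul_inv_cancel₀ hr0, Real.rpow_one]
  have hF : ‖lpSum p₂ (fun i => u i • T (e i))‖ ≤ C := by
    have h1 := hT n fun i => u i • e i
    simp only [map_smul] at h1
    refine h1.trans (mul_le_of_le_one_right (by linarith) ?_)
    have h2 : ∀ i, ‖u i • e i‖ ≤ w i ^ (p.toReal)⁻¹ := by
      intro i
      rw [norm_smul, Real.norm_of_nonneg (hu0 i)]
      calc u i * ‖e i‖ ≤ u i * a i := mul_le_mul_of_nonneg_left (hea i) (hu0 i)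
        _ = _ := div_mul_cancel₀ _ (ha i).ne'
    refine (norm_toLp_mono hp (fun i => norm_nonneg _) h2).trans ?_
    -- For `p = ∞` the exponent `(p.toReal)⁻¹` is `0`, so every bounding entry equals `1`.
    rcases eq_or_ne p ⊤ with rfl | hpT
    · rw [norm_toLp_top_le_iff _ zero_le_one]
      simp
    · have hp0 := toReal_pos_of_one_le hp hpT
      rw [norm_toLp_le_iff hp0 _ zero_le_one, Real.one_rpow]
      refine le_trans (le_of_eq (Finset.sum_congr rfl fun i _ => ?_)) hc1
      rw [abs_of_nonneg (Real.rpow_nonneg (hw0 i) _), ← Real.rpow_mul (hw0 i),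
        inv_mul_cancel₀ hp0.ne', Real.rpow_one]
  have hG : ‖∑ i, v i • |T (e i)|‖ ≤ 1 := by
    refine (norm_sum_le _ _).trans (le_trans (Finset.sum_le_sum fun i _ => ?_) hc1)
    rw [norm_smul, Real.norm_of_nonneg (hv0 i), norm_abs_eq_norm]
    calc v i * ‖T (e i)‖ ≤ v i * b i :=
          mul_le_mul_of_nonneg_left ((h.norm_map_le _).trans (heb i)) (hv0 i)
      _ = _ := div_mul_cancel₀ _ (hb i).ne'
  have hle := lpSum_geom_mean_le hθ₀ hθ₁ hball hu0 hv0 (fun i => T (e i))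
  simp only [huv] at hle
  calc _ ≤ ‖θ • lpSum p₂ (fun i => u i • T (e i)) + (1 - θ) • ∑ i, v i • |T (e i)|‖ :=
        norm_le_norm_of_nonneg_of_le (lpSum_nonneg _ _) hle
    _ ≤ θ * C + (1 - θ) * 1 := by
        refine (norm_add_le _ _).trans ?_
        rw [norm_smul, norm_smul, Real.norm_of_nonneg hθ₀.le, Real.norm_of_nonneg h1θ.le]
        gcongr
    _ ≤ C := by nlinarith

/-- Sublinearity of `lpSum` makes the norm a convex function of the whole tuple, so its bound on
`Aⁿ` extends to the product of the hulls. -/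
theorem norm_lpSum_le_of_mem_convexHull {X : Type u} [NormedAddCommGroup X] [NormedSpace ℝ X]
    {T : X →L[ℝ] Y} {s : ℝ≥0∞} {A : Set X} {n : ℕ} {c : Fin n → ℝ} {C : ℝ}
    (h : ∀ e : Fin n → X, (∀ i, e i ∈ A) → ‖lpSum s (fun i => c i • T (e i))‖ ≤ C)
    {e : Fin n → X} (he : ∀ i, e i ∈ convexHull ℝ A) :
    ‖lpSum s (fun i => c i • T (e i))‖ ≤ C := by
  have hconv : Convex ℝ {e : Fin n → X | ‖lpSum s (fun i => c i • T (e i))‖ ≤ C} := by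
    intro e he f hf a b ha hb hab
    have h1 : (fun i => c i • T ((a • e + b • f) i)) =
        a • (fun i => c i • T (e i)) + b • fun i => c i • T (f i) := by
      ext i
      simp only [Pi.add_apply, Pi.smul_apply, map_add, map_smul, smul_add, smul_comm (c i)]
    calc ‖lpSum s (fun i => c i • T ((a • e + b • f) i))‖
        ≤ ‖a • lpSum s (fun i => c i • T (e i)) + b • lpSum s (fun i => c i • T (f i))‖ := by
          refine norm_le_norm_of_nonneg_of_le (lpSum_nonneg _ _) ?_
          rw [h1, ← lpSum_smul s ha, ← lpSum_smul s hb]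
          exact lpSum_add_le s _ _
      _ ≤ a * C + b * C := by
          refine (norm_add_le _ _).trans ?_
          rw [norm_smul, norm_smul, Real.norm_of_nonneg ha, Real.norm_of_nonneg hb]
          exact add_le_add (mul_le_mul_of_nonneg_left he ha) (mul_le_mul_of_nonneg_left hf hb)
      _ = C := by rw [← add_mul, hab, one_mul]
  have hsub : Set.univ.pi (fun _ : Fin n => A) ⊆
      {e : Fin n → X | ‖lpSum s (fun i => c i • T (e i))‖ ≤ C} := fun e he => h e fun i => he i trivial
  have := convexHull_min hsub hconv
  rw [convexHull_pi] at this
  exact this fun i _ => he i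

theorem norm_lpSum_le_of_denseRange {X : Type*} {W : Type u} [NormedAddCommGroup W] [NormedSpace ℝ W]
    {ψ : X → W} (hψ : DenseRange ψ) (S : W →L[ℝ] Y) {s : ℝ≥0∞} {n : ℕ} {c : Fin n → ℝ} {C : ℝ}
    (h : ∀ e : Fin n → X, (∀ i, ‖ψ (e i)‖ < 1) → ‖lpSum s (fun i => c i • S (ψ (e i)))‖ ≤ C)
    {w : Fin n → W} (hw : ∀ i, ‖w i‖ < 1) : ‖lpSum s (fun i => c i • S (w i))‖ ≤ C := by
  have hcl : IsClosed {w : Fin n → W | ‖lpSum s (fun i => c i • S (w i))‖ ≤ C} :=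
    isClosed_le ((continuous_lpSum s n).comp (by fun_prop)).norm continuous_const
  have hsub : Set.univ.pi (fun _ : Fin n => Metric.ball (0 : W) 1 ∩ Set.range ψ) ⊆
      {w : Fin n → W | ‖lpSum s (fun i => c i • S (w i))‖ ≤ C} := by
    intro w hw
    choose e he using fun i => (hw i trivial).2
    obtain rfl : (fun i => ψ (e i)) = w := funext he
    exact h e fun i => by simpa using (hw i trivial).1
  have := closure_minimal hsub hcl
  rw [closure_pi_set] at this
  refine this fun i _ => hψ.open_subset_closure_inter Metric.isOpen_ball ?_
  simpa using hw i

theorem isConcaveLattice_of_denseRange {X : Type*} {W : Type u} [NormedAddCommGroup W] [NormedSpace ℝ W]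
    [Lattice W] [IsBanachLattice W] {ψ : X → W} (hψ : DenseRange ψ) {q : ℝ≥0∞} (hq : 1 ≤ q)
    (h : ∀ (n : ℕ) (x : Fin n → X),
      ‖WithLp.toLp q (fun i => ‖ψ (x i)‖)‖ ≤ ‖∑ i, |ψ (x i)|‖) : IsConcaveLattice q 1 W := by
  have : Fact (1 ≤ q) := ⟨hq⟩
  refine ⟨1, le_rfl, fun n w => ?_⟩
  rw [one_mul, lpSum_one]
  simp only [ContinuousLinearMap.id_apply]
  have hcl : IsClosed {w : Fin n → W | ‖WithLp.toLp q (fun i => ‖w i‖)‖ ≤ ‖∑ i, |w i|‖} := by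
    refine isClosed_le (Continuous.norm ?_) (Continuous.norm ?_)
    · exact (PiLp.continuous_toLp q _).comp (by fun_prop)
    · unfold abs
      fun_prop
  have hsub : Set.univ.pi (fun _ : Fin n => Set.range ψ) ⊆
      {w : Fin n → W | ‖WithLp.toLp q (fun i => ‖w i‖)‖ ≤ ‖∑ i, |w i|‖} := by
    intro w hw
    choose e he using fun i => hw i trivial
    obtain rfl : (fun i => ψ (e i)) = w := funext he
    exact h n e
  have := closure_minimal hsub hcl
  rw [closure_pi_set] at this
  exact this fun i _ => hψ (w i)

end Interpolation

/-! ### Assembly of the factorization. -/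

theorem mainTheorem8 {X : Type u} {Y : Type v}
    [NormedAddCommGroup X] [NormedSpace ℝ X] [Lattice X] [IsBanachLattice X]
    [NormedAddCommGroup Y] [NormedSpace ℝ Y] [Lattice Y] [IsBanachLattice Y]
    (p p₂ q : ℝ≥0∞) (hp : 1 ≤ p) (hq : 1 ≤ q)
    (T : X →L[ℝ] Y) (hconvex : IsConvexOperator p p₂ T) (hconcave : IsConcaveOperator q 1 T)
    (θ : ℝ) (hθ₀ : 0 < θ) (hθ₁ : θ < 1)
    (pθ p₂' qθ : ℝ≥0∞)
    (hpθ : 1 / pθ = ENNReal.ofReal θ / p + ENNReal.ofReal (1 - θ))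
    (hqθ : qθ = q / ENNReal.ofReal (1 - θ))
    (hp₂ : (p₂ = p ∧ p₂' = pθ) ∨ (p₂ = ⊤ ∧ p₂' = ⊤)) :
    ∃ (Z : Type v) (_ : NormedAddCommGroup Z) (_ : NormedSpace ℝ Z) (_ : Lattice Z)
      (_ : IsBanachLattice Z)
      (W : Type u) (_ : NormedAddCommGroup W) (_ : NormedSpace ℝ W) (_ : Lattice W)
      (_ : IsBanachLattice W)
      (Φ : Z →L[ℝ] Y) (Tθ : W →L[ℝ] Z) (Ψ : X →L[ℝ] W),
      IsConvexLattice pθ p₂' Z ∧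
      IsConcaveLattice qθ 1 W ∧
      IsLatticeHom Φ ∧ Function.Injective Φ ∧ IsIntervalPreserving Φ ∧
      IsClassD Ψ ∧
      T = Φ ∘L Tθ ∘L Ψ := by
  subst hqθ
  obtain ⟨K, ρ, hρ⟩ := exists_isLowerNorm hq hconcave
  obtain ⟨C, hC1, hC⟩ := hconvex
  have hr := inv_toReal_of_one_div_eq hp hθ₀ hθ₁ hpθ
  -- The exponent `pθ` is finite even for `p = ∞`, because `1/pθ ≥ 1 - θ > 0`.
  have hr0 : 0 < pθ.toReal := by
    rw [← inv_pos, hr]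
    have : 0 ≤ (p.toReal)⁻¹ := inv_nonneg.2 ENNReal.toReal_nonneg
    have := mul_nonneg hθ₀.le this
    linarith
  have hball : ∀ n, ∀ a ∈ dualBall p₂' n, (fun i => |a i| ^ θ⁻¹) ∈ dualBall p₂ n := by
    intro n a ha
    rcases hp₂ with ⟨rfl, rfl⟩ | ⟨rfl, rfl⟩
    · exact rpow_mem_dualBall hp hθ₀ hθ₁ hpθ ha
    · exact rpow_mem_dualBall_self hθ₀ hθ₁ ha
  have hkey : ∀ (n : ℕ) (c : Fin n → ℝ) (e : Fin n → X), (∀ i, 0 ≤ c i) →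
      ∑ i, c i ^ pθ.toReal ≤ 1 → (∀ i, hρ.seminorm θ (e i) < 1) →
      ‖lpSum p₂' (fun i => c i • T (e i))‖ ≤ C := fun n c e hc hc1 he =>
    norm_lpSum_le_of_mem_convexHull (fun e he => hρ.norm_lpSum_le_of_mem_atoms hp hr hθ₀ hθ₁ hC1 hC
      (hball n) hc hc1 he) fun i => hρ.mem_of_seminorm_lt_one (he i)
  obtain ⟨W, j₁, j₂, j₃, j₄, ψ, hψn, hψd, hψl⟩ :=
    exists_banachLattice_of_solid_seminorm (hρ.seminorm θ) fun x y => hρ.seminorm_mono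
  have hψabs : ∀ x, |ψ x| = ψ |x| := fun x => by rw [abs, abs, (hψl _ _).1, map_neg]
  -- The one-vector case of `hkey` bounds `T` by the interpolated seminorm, so `T` vanishes on its
  -- kernel and extends to the completion `W`.
  have hTN : ∀ x, ‖T x‖ ≤ C * ‖ψ x‖ := by
    intro x
    rw [hψn]
    have h1 : ∀ y, hρ.seminorm θ y < 1 → ‖T y‖ ≤ C := by
      intro y hy
      have h2 := hkey 1 (fun _ => 1) (fun _ => y) (by simp) (by simp) fun _ => hy
      simp only [one_smul] at h2
      exact (norm_le_norm_of_abs_le_abs ((abs_le_lpSum p₂' (fun _ : Fin 1 => T y) 0).trans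
        (le_abs_self _))).trans h2
    have h2 : ∀ t, hρ.seminorm θ x < t → ‖T x‖ ≤ C * t := by
      intro t ht
      have ht0 : 0 < t := (apply_nonneg _ _).trans_lt ht
      have h3 := h1 (t⁻¹ • x) (by
        rw [map_smul_eq_mul, norm_inv, Real.norm_of_nonneg ht0.le, inv_mul_lt_iff₀ ht0, mul_one]
        exact ht)
      rw [map_smul, norm_smul, norm_inv, Real.norm_of_nonneg ht0.le, inv_mul_le_iff₀ ht0] at h3
      linarith
    rw [← div_le_iff₀' (by linarith)]
    refine le_of_forall_gt_imp_ge_of_dense fun t ht => ?_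
    rw [div_le_iff₀' (by linarith)]
    exact h2 t ht
  let S : W →L[ℝ] Y := T.toLinearMap.extendOfNorm ψ
  have hS : ∀ x, S (ψ x) = T x := fun x => LinearMap.extendOfNorm_eq hψd ⟨C, hTN⟩ x
  have hSconv : IsConvexOperator pθ p₂' S := by
    refine isConvexOperator_of_norm_lpSum_le hr0 hC1 fun n c w hc hc1 hw =>
      norm_lpSum_le_of_denseRange hψd S (fun e he => ?_) hw
    simp only [hS]
    exact hkey n c e hc hc1 fun i => by rw [← hψn]; exact he i
  obtain ⟨Z, i₁, i₂, i₃, i₄, Φ, R, hZ, hΦl, hΦi, hΦp, hΦR⟩ :=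
    exists_factorization_convexLattice hr0 hSconv
  refine ⟨Z, i₁, i₂, i₃, i₄, W, j₁, j₂, j₃, j₄, Φ, R,
    ψ.mkContinuous (|K| + 1) fun x => (hψn x).trans_le (hρ.seminorm_le_norm x), hZ, ?_, hΦl, hΦi,
    hΦp, ⟨hψl, hψd⟩, ?_⟩
  · refine isConcaveLattice_of_denseRange hψd (one_le_div_ofReal hq hθ₀) fun n x => ?_
    simp only [hψabs, ← map_sum, hψn]
    exact hρ.norm_toLp_seminorm_le hq hθ₀ hθ₁ x
  · ext x
    change T x = Φ (R (ψ x))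
    rw [← hS x, hΦR]
    rfl
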